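/- Fix a dimension $d$ and a nonzero Schwartz function $g\in\mathcal S(\mathbb R^d)$. For $1\le q\le\infty$ the modulation space $M^q(\mathbb R^d)$ consists of the tempered distributions $\psi$ with $\|\psi\|_{M^q}=\|V_g\psi\|_{L^q(\mathbb R^{2d})}<\infty$, where $V_g\psi(x,\omega)=\langle\psi,\pi(x,\omega)g\rangle$ and $\pi(x,\omega)g(t)=e^{2\pi i\omega\cdot t}g(t-x)$ (different windows $g$ give equivalent norms). For $\varphi,\psi\in L^2(\mathbb R^d)$ write $V_\varphi\psi(x,\omega)=\int_{\mathbb R^d}\psi(t)\overline{\varphi(t-x)}e^{-2\pi i\omega\cdot t}\,dt$, and for $\mu\in L^1(\mathbb R^{2d})$ let $$B_\mu^\varphi\psi=V_\varphi^*(\mu*V_\varphi\psi)=\int_{\mathbb R^{2d}}(\mu*V_\varphi\psi)(z)\,\pi(z)\varphi\,dz,$$ where $V_\varphi^*$ is the adjoint of $V_\varphi$ on $L^2$, i.e. the integral is understood weakly: $\langle B_\mu^\varphi\psi,h\rangle=\int_{\mathbb R^{2d}}(\mu*V_\varphi\psi)(z)\overline{V_\varphi h(z)}\,dz$ for all $h\in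 L^2(\mathbb R^d)$. Let $1\le p\le2$ and $\varphi\in M^1(\mathbb R^d)$. Then there is a constant $C$, depending only on $\varphi$ and $p$ (and on $d$ and the window $g$ fixed in the norms), such that for all $\mu\in L^1(\mathbb R^{2d})$ and all $\psi\in M^p(\mathbb R^d)$ the following holds: $\varphi$ and $\psi$ are functions in $L^2(\mathbb R^d)$, so that $B_\mu^\varphi\psi\in L^2(\mathbb R^d)$ is defined, $B_\mu^\varphi\psi$ belongs to $L^p(\mathbb R^d)$, and $$\|B_\mu^\varphi\psi\|_{L^p(\mathbb R^d)}\le C\,\|\mu\|_{L^1(\mathbb R^{2d})}\,\|\psi\|_{M^p(\mathbb R^d)}.$$ -/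

import Mathlib

open MeasureTheory
open scoped SchwartzMap ENNReal NNReal

/-- `ℝᵈ` with its Euclidean structure and Lebesgue measure. -/
abbrev TFSpace (d : ℕ) : Type := EuclideanSpace ℝ (Fin d)

/-- The time-frequency plane `ℝ²ᵈ = ℝᵈ × ℝᵈ`, with points `z = (x, ω)` and Lebesgue measure. -/
abbrev TFPlane (d : ℕ) : Type := TFSpace d × TFSpace d

/-- The conjugate character `t ↦ exp (-2πi ω·t)`. -/
noncomputable def tfCharConj {d : ℕ} (ω t : TFSpace d) : ℂ :=
  Complex.exp (-(2 * Real.pi * inner ℝ ω t : ℝ) * Complex.I)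

theorem tfCharConj_hasTemperateGrowth {d : ℕ} (ω : TFSpace d) :
    Function.HasTemperateGrowth (tfCharConj ω) := by
  have hI : ∀ s : ℝ, ‖Complex.exp (-(s : ℂ) * Complex.I)‖ = 1 := fun s => by
    simpa using Complex.norm_exp_ofReal_mul_I (-s)
  have hit : ∀ n : ℕ, iteratedDeriv n (fun s : ℝ => Complex.exp (-(s : ℂ) * Complex.I))
      = fun s : ℝ => (-Complex.I) ^ n * Complex.exp (-(s : ℂ) * Complex.I) := by
    intro n
    induction n with
    | zero => simp
    | succ n ih =>
      rw [iteratedDeriv_succ, ih]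
      funext s
      have h1 : HasDerivAt (fun s : ℝ => -(s : ℂ) * Complex.I) (-1 * Complex.I) s :=
        ((Complex.ofRealCLM.hasDerivAt (x := s)).neg).mul_const Complex.I
      have h2 := (h1.cexp.const_mul ((-Complex.I) ^ n)).deriv
      rw [h2]
      ring
  have hexp : Function.HasTemperateGrowth
      (fun s : ℝ => Complex.exp (-(s : ℂ) * Complex.I)) := by
    refine ⟨?_, fun n => ⟨0, 1, fun s => ?_⟩⟩
    · have : ContDiff ℝ ((⊤ : ℕ∞) : WithTop ℕ∞) (fun s : ℝ => (s : ℂ)) := Complex.ofRealCLM.contDiff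
      exact (this.neg.mul contDiff_const).cexp
    · rw [norm_iteratedFDeriv_eq_norm_iteratedDeriv, hit n, norm_mul, hI]
      simp
  have := hexp.comp ((2 * Real.pi) • innerSL ℝ ω).hasTemperateGrowth
  convert this using 1
  funext t
  simp [tfCharConj]

/-- The conjugate of the time-frequency shift of a Schwartz function: for `z = (x, ω)`, the
Schwartz function `t ↦ conj (g (t - x)) * exp (-2πi ω·t)`. -/
noncomputable def tfShiftConj {d : ℕ} (g : 𝓢(TFSpace d, ℂ)) (z : TFPlane d) : 𝓢(TFSpace d, ℂ) :=
  SchwartzMap.smulLeftCLM ℂ (tfCharConj z.2)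
    ((g.compSubConstCLM ℝ z.1).postcompCLM (Complex.conjCLE : ℂ →L[ℝ] ℂ))

theorem tfShiftConj_apply {d : ℕ} (g : 𝓢(TFSpace d, ℂ)) (z : TFPlane d) (t : TFSpace d) :
    tfShiftConj g z t = tfCharConj z.2 t * starRingEnd ℂ (g (t - z.1)) := by
  rw [tfShiftConj, SchwartzMap.smulLeftCLM_apply_apply (tfCharConj_hasTemperateGrowth z.2)]
  simp

/-- The short-time Fourier transform `V_g ψ (x, ω) = ⟨ψ, M_ω T_x g⟩` of a tempered distribution
`ψ` with respect to a Schwartz window `g`. -/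
noncomputable def stftDistribution {d : ℕ} (g : 𝓢(TFSpace d, ℂ)) (ψ : 𝓢'(TFSpace d, ℂ))
    (z : TFPlane d) : ℂ :=
  ψ (tfShiftConj g z)

/-- The modulation space norm `‖ψ‖_{M^p}`, computed with the Schwartz window `g`:
the `L^p(ℝ²ᵈ)` norm of `V_g ψ`. -/
noncomputable def modulationNorm {d : ℕ} (g : 𝓢(TFSpace d, ℂ)) (p : ℝ≥0∞)
    (ψ : 𝓢'(TFSpace d, ℂ)) : ℝ≥0∞ :=
  eLpNorm (stftDistribution g ψ) p volume

/-- The modulation space `M^p(ℝᵈ)`: the tempered distributions of finite modulation space norm. -/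
def modulationSpace {d : ℕ} (g : 𝓢(TFSpace d, ℂ)) (p : ℝ≥0∞) : Set 𝓢'(TFSpace d, ℂ) :=
  {ψ | modulationNorm g p ψ < ∞}

/-- The short-time Fourier transform of a signal `ψ` with window `φ`,
`V_φ ψ (x, ω) = ∫ ψ(t) conj (φ(t - x)) exp (-2πi ω·t) dt`, used for `φ, ψ ∈ L²(ℝᵈ)`. -/
noncomputable def stft {d : ℕ} (φ ψ : TFSpace d → ℂ) (z : TFPlane d) : ℂ :=
  ∫ t, ψ t * starRingEnd ℂ (φ (t - z.1)) * tfCharConj z.2 t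

/-- The two short-time Fourier transforms agree for `ψ ∈ L²(ℝᵈ)` and a Schwartz window. -/
theorem stftDistribution_toTemperedDistribution {d : ℕ} (g : 𝓢(TFSpace d, ℂ))
    (ψ : Lp ℂ 2 (volume : Measure (TFSpace d))) (z : TFPlane d) :
    stftDistribution g (Lp.toTemperedDistribution ψ) z = stft g ψ z := by
  rw [stftDistribution, Lp.toTemperedDistribution_apply, stft]
  refine integral_congr_ae (Filter.Eventually.of_forall fun t => ?_)
  simp only [tfShiftConj_apply, smul_eq_mul]
  ring

/-- `f = V_φ^* F = ∫ F(z) π(z)φ dz` in `L²(ℝᵈ)`, where `V_φ^*` is the adjoint of `V_φ`; that is,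
the integral holds weakly:
`⟨f, h⟩ = ∫ F(z) conj (V_φ h (z)) dz` (convergent integral) for all `h ∈ L²(ℝᵈ)`. -/
def IsAdjointSTFT {d : ℕ} (φ : Lp ℂ 2 (volume : Measure (TFSpace d))) (F : TFPlane d → ℂ)
    (f : Lp ℂ 2 (volume : Measure (TFSpace d))) : Prop :=
  ∀ h : Lp ℂ 2 (volume : Measure (TFSpace d)),
    Integrable (fun z => F z * starRingEnd ℂ (stft φ h z)) volume ∧
      inner ℂ h f = ∫ z, F z * starRingEnd ℂ (stft φ h z)

/-- `f = B_μ^φ ψ = V_φ^* (μ * V_φ ψ)`. The window and the signal are tempered distributions;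
the relation contains the claim that they are functions in `L²(ℝᵈ)`. -/
def IsBlurring {d : ℕ} (μ : TFPlane d → ℂ) (φ ψ : 𝓢'(TFSpace d, ℂ))
    (f : Lp ℂ 2 (volume : Measure (TFSpace d))) : Prop :=
  ∃ φ₀ ψ₀ : Lp ℂ 2 (volume : Measure (TFSpace d)),
    Lp.toTemperedDistribution φ₀ = φ ∧ Lp.toTemperedDistribution ψ₀ = ψ ∧
      IsAdjointSTFT φ₀ (convolution μ (stft φ₀ ψ₀) (ContinuousLinearMap.mul ℂ ℂ) volume) f

/-- `B_μ^φ ψ` is uniquely determined. -/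
theorem IsBlurring.unique {d : ℕ} {μ : TFPlane d → ℂ} {φ ψ : 𝓢'(TFSpace d, ℂ)}
    {f f' : Lp ℂ 2 (volume : Measure (TFSpace d))}
    (hf : IsBlurring μ φ ψ f) (hf' : IsBlurring μ φ ψ f') : f = f' := by
  have inj : ∀ a b : Lp ℂ 2 (volume : Measure (TFSpace d)),
      Lp.toTemperedDistribution a = Lp.toTemperedDistribution b → a = b := fun a b h =>
    LinearMap.ker_eq_bot.mp
      (Lp.ker_toTemperedDistributionCLM_eq_bot (F := ℂ)
        (μ := (volume : Measure (TFSpace d))) (p := 2)) h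
  obtain ⟨φ₀, ψ₀, h1, h2, h3⟩ := hf
  obtain ⟨φ₁, ψ₁, k1, k2, k3⟩ := hf'
  obtain rfl := inj φ₀ φ₁ (h1.trans k1.symm)
  obtain rfl := inj ψ₀ ψ₁ (h2.trans k2.symm)
  exact ext_inner_left ℂ fun h => (h3 h).2.trans (k3 h).2.symm

/-! Write `γ` for the fixed Schwartz window `g` seen in `L²`. Three convolution estimates in the
time-frequency plane control the modulation norm of `B_μ^φ ψ`, and an embedding then returns to
`L^p`. Moyal's identity gives `‖γ‖² |V_φ ψ| ≤ |V_φ γ| * |V_γ ψ|` (`enorm_stft_le_lintegral`), hence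
`‖γ‖² ‖V_φ ψ‖_p ≤ ‖V_γ φ‖_1 ‖V_γ ψ‖_p`. Convolution with `μ` costs a factor `‖μ‖_1`. Since `V_γ f
(w) = ⟨f, π(w)γ⟩`, the adjoint satisfies `|V_γ V_φ^* F| ≤ |V_γ φ| * |F|`
(`IsAdjointSTFT.eLpNorm_stft_le`). So `φ ∈ M¹` enters twice, through `‖V_γ φ‖_1`.

The embedding `M^p ⊆ L^p` (`exists_eLpNorm_le_eLpNorm_stft`) is where `p ≤ 2` matters most. A
windowed piece `f · w(· - x)` has Fourier transform `V_g f (x, ·)`. Multiplying by a second window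
convolves this transform with a Schwartz function, which improves `L^p` to `L²`; Plancherel brings
the bound back to the time side, and a third window with Hölder lowers `L²` to `L^p`. Integrating
`p`-th powers over `x` finishes.

It remains to see that `φ` and `ψ`, given as distributions, lie in `L²`. The inversion formula `‖g‖²
ψ(h) = ∫ conj (V_g h̄) V_g ψ` (`TemperedDistribution.mul_integral_norm_sq_eq`) follows by moving `ψ`
through a Schwartz-valued integral. It yields `‖g‖² |V_g ψ| ≤ |V_g g| * |V_g ψ|`, so `V_g ψ ∈ L²`.
Cauchy-Schwarz in the same formula makes `ψ` bounded for the `L²` norm, and Riesz representation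
applies. -/

/-! ### Tempered distributions applied to integrals of Schwartz functions -/

section SchwartzIntegral

variable {E : Type*} [NormedAddCommGroup E] [NormedSpace ℝ E]

/-- A weighted derivative `t ↦ ‖t‖ ^ k • Dⁿ f (t)` of a Schwartz function, as a bounded continuous
function. -/
noncomputable def SchwartzMap.weightedDeriv (k n : ℕ) (f : 𝓢(E, ℂ)) :
    BoundedContinuousFunction E (E [×n]→L[ℝ] ℂ) :=
  BoundedContinuousFunction.ofNormedAddCommGroup
    (fun t => ‖t‖ ^ k • iteratedFDeriv ℝ n f t)
    (((continuous_norm).pow k).smul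
      ((f.smooth n).continuous_iteratedFDeriv (m := n) le_rfl))
    (SchwartzMap.seminorm ℂ k n f) (fun t => by
      rw [norm_smul, norm_pow, norm_norm]; exact f.le_seminorm ℂ k n t)

theorem SchwartzMap.norm_weightedDeriv_le (k n : ℕ) (f : 𝓢(E, ℂ)) :
    ‖SchwartzMap.weightedDeriv k n f‖ ≤ SchwartzMap.seminorm ℂ k n f :=
  (BoundedContinuousFunction.norm_le (apply_nonneg _ _)).2 fun t => by
    change ‖‖t‖ ^ k • iteratedFDeriv ℝ n f t‖ ≤ _
    rw [norm_smul, norm_pow, norm_norm]; exact f.le_seminorm ℂ k n t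

/-- `SchwartzMap.weightedDeriv` as a continuous linear map. -/
noncomputable def SchwartzMap.weightedDerivCLM (k n : ℕ) :
    𝓢(E, ℂ) →L[ℂ] BoundedContinuousFunction E (E [×n]→L[ℝ] ℂ) :=
  SchwartzMap.mkCLMtoNormedSpace (D := E) (E := ℂ) (σ := RingHom.id ℂ)
    (G := BoundedContinuousFunction E (E [×n]→L[ℝ] ℂ)) (SchwartzMap.weightedDeriv k n)
    (fun f g => by
      ext1 t
      change ‖t‖ ^ k • iteratedFDeriv ℝ n (⇑f + ⇑g) t
        = ‖t‖ ^ k • iteratedFDeriv ℝ n f t + ‖t‖ ^ k • iteratedFDeriv ℝ n g t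
      rw [← smul_add, ← iteratedFDeriv_add_apply (f.smooth n).contDiffAt (g.smooth n).contDiffAt])
    (fun a f => by
      ext1 t
      change ‖t‖ ^ k • iteratedFDeriv ℝ n (a • ⇑f) t = a • ‖t‖ ^ k • iteratedFDeriv ℝ n f t
      rw [iteratedFDeriv_const_smul_apply (f.smooth n).contDiffAt, smul_comm])
    ⟨{(k, n)}, 1, zero_le_one, fun f => by
      simp only [Finset.sup_singleton, one_mul]
      exact SchwartzMap.norm_weightedDeriv_le k n f⟩

theorem SchwartzMap.weightedDerivCLM_apply_apply (k n : ℕ) (f : 𝓢(E, ℂ)) (t : E) :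
    SchwartzMap.weightedDerivCLM k n f t = ‖t‖ ^ k • iteratedFDeriv ℝ n f t := rfl

theorem SchwartzMap.norm_weightedDerivCLM_le (k n : ℕ) (f : 𝓢(E, ℂ)) :
    ‖SchwartzMap.weightedDerivCLM k n f‖ ≤ SchwartzMap.seminorm ℂ k n f :=
  SchwartzMap.norm_weightedDeriv_le k n f

theorem SchwartzMap.seminorm_le_norm_weightedDerivCLM (k n : ℕ) (f : 𝓢(E, ℂ)) :
    SchwartzMap.seminorm ℂ k n f ≤ ‖SchwartzMap.weightedDerivCLM k n f‖ :=
  f.seminorm_le_bound ℂ k n (norm_nonneg (SchwartzMap.weightedDerivCLM k n f)) fun t => by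
    have := (SchwartzMap.weightedDerivCLM k n f).norm_coe_le_norm t
    rwa [weightedDerivCLM_apply_apply, norm_smul, norm_pow, norm_norm] at this

/-- The map of `n`-th derivatives at a point is continuous on Schwartz space. -/
theorem SchwartzMap.continuous_iteratedFDeriv_apply (n : ℕ) (t : E) :
    Continuous fun f : 𝓢(E, ℂ) => iteratedFDeriv ℝ n f t := by
  have : (fun f : 𝓢(E, ℂ) => iteratedFDeriv ℝ n f t)
      = fun f => (SchwartzMap.weightedDerivCLM 0 n f) t := by
    funext f; simp [weightedDerivCLM_apply_apply]
  rw [this]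
  exact (BoundedContinuousFunction.evalCLM ℂ t).continuous.comp
    (SchwartzMap.weightedDerivCLM 0 n).continuous

variable {Z : Type*} [TopologicalSpace Z] [SecondCountableTopology Z] [MeasurableSpace Z]
  [OpensMeasurableSpace Z] {ν : Measure Z}

theorem SchwartzMap.integrable_iteratedFDeriv_of_integrable_seminorm {Φ : Z → 𝓢(E, ℂ)}
    (hΦ : Continuous Φ)
    (hint : ∀ k n, Integrable (fun z => SchwartzMap.seminorm ℂ k n (Φ z)) ν) (n : ℕ) (t : E) :
    Integrable (fun z => iteratedFDeriv ℝ n (Φ z) t) ν :=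
  (hint 0 n).mono' ((continuous_iteratedFDeriv_apply n t).comp hΦ).aestronglyMeasurable
    (Filter.Eventually.of_forall fun z => by simpa using (Φ z).le_seminorm ℂ 0 n t)

/-- Differentiation under the integral sign, by induction on `n`. That `h` is Schwartz is assumed,
so only its derivatives have to be identified. -/
theorem SchwartzMap.iteratedFDeriv_eq_integral {Φ : Z → 𝓢(E, ℂ)} (hΦ : Continuous Φ)
    (hint : ∀ k n, Integrable (fun z => SchwartzMap.seminorm ℂ k n (Φ z)) ν) {h : 𝓢(E, ℂ)}
    (hh : ∀ t, h t = ∫ z, Φ z t ∂ν) (n : ℕ) (t : E) :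
    iteratedFDeriv ℝ n h t = ∫ z, iteratedFDeriv ℝ n (Φ z) t ∂ν := by
  induction n generalizing t with
  | zero =>
    have e : ∀ f : 𝓢(E, ℂ), iteratedFDeriv ℝ 0 f t
        = (continuousMultilinearCurryFin0 ℝ E ℂ).symm (f t) := fun f => rfl
    simp only [e, hh]
    exact ((continuousMultilinearCurryFin0 ℝ E ℂ).symm.toContinuousLinearEquiv.integral_comp_comm
      (fun z => Φ z t)).symm
  | succ n ih =>
    have e : ∀ f : 𝓢(E, ℂ), iteratedFDeriv ℝ (n + 1) f t
        = (continuousMultilinearCurryLeftEquiv ℝ (fun _ : Fin (n + 1) => E) ℂ).symm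
          (fderiv ℝ (iteratedFDeriv ℝ n f) t) := fun f => rfl
    have e' : ∀ (f : 𝓢(E, ℂ)) (t : E), fderiv ℝ (iteratedFDeriv ℝ n f) t
        = continuousMultilinearCurryLeftEquiv ℝ (fun _ : Fin (n + 1) => E) ℂ
          (iteratedFDeriv ℝ (n + 1) f t) := fun f t => by
      rw [iteratedFDeriv_succ_eq_comp_left]; simp
    have key : HasFDerivAt (fun t => ∫ z, iteratedFDeriv ℝ n (Φ z) t ∂ν)
        (∫ z, fderiv ℝ (iteratedFDeriv ℝ n (Φ z)) t ∂ν) t := by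
      refine hasFDerivAt_integral_of_dominated_of_fderiv_le (s := Set.univ)
        (F' := fun t z => fderiv ℝ (iteratedFDeriv ℝ n (Φ z)) t)
        -- The seminorm of order `(0, n + 1)` dominates the next derivative uniformly in `t`.
        (bound := fun z => SchwartzMap.seminorm ℂ 0 (n + 1) (Φ z)) Filter.univ_mem ?_ ?_ ?_ ?_
        (hint 0 (n + 1)) ?_
      · exact Filter.Eventually.of_forall fun t =>
          (integrable_iteratedFDeriv_of_integrable_seminorm hΦ hint n t).aestronglyMeasurable
      · exact integrable_iteratedFDeriv_of_integrable_seminorm hΦ hint n t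
      · simp only [e']
        exact ((LinearIsometryEquiv.continuous _).comp
          ((continuous_iteratedFDeriv_apply (n + 1) t).comp hΦ)).aestronglyMeasurable
      · refine Filter.Eventually.of_forall fun z t _ => ?_
        rw [e', LinearIsometryEquiv.norm_map]
        simpa using (Φ z).le_seminorm ℂ 0 (n + 1) t
      · refine Filter.Eventually.of_forall fun z t _ => ?_
        exact (((Φ z).smooth (n + 1 : ℕ)).differentiable_iteratedFDeriv
          (by exact_mod_cast Nat.lt_succ_self n) t).hasFDerivAt
    rw [e, funext ih, key.fderiv]
    simp only [e]
    exact (ContinuousLinearEquiv.integral_comp_comm (𝕜 := ℝ) (E := E →L[ℝ] E [×n]→L[ℝ] ℂ)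
      (F := E [×(n + 1)]→L[ℝ] ℂ) (continuousMultilinearCurryLeftEquiv ℝ (fun _ : Fin (n + 1) => E)
      ℂ).symm.toContinuousLinearEquiv
      (fun z => fderiv ℝ (iteratedFDeriv ℝ n (Φ z)) t)).symm

/-- A linear functional that is dominated by the norm of an injective linear map into a normed space
factors through a continuous linear functional. -/
theorem LinearMap.exists_strongDual_comp_eq {V X : Type*} [AddCommGroup V] [Module ℂ V]
    [NormedAddCommGroup X] [NormedSpace ℂ X] (J : V →ₗ[ℂ] X) (hJ : Function.Injective J)
    (ψ : V →ₗ[ℂ] ℂ) (C : ℝ) (h : ∀ f, ‖ψ f‖ ≤ C * ‖J f‖) :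
    ∃ Ψ : StrongDual ℂ X, ∀ f, Ψ (J f) = ψ f := by
  let e := LinearEquiv.ofInjective J hJ
  have he : ∀ f, ((e f : LinearMap.range J) : X) = J f := fun f => rfl
  obtain ⟨Ψ, hΨ, -⟩ := exists_extension_norm_eq (LinearMap.range J)
    ((ψ ∘ₗ e.symm.toLinearMap).mkContinuous C (fun y => by
      have := h (e.symm y)
      rw [← he, e.apply_symm_apply] at this
      exact this))
  refine ⟨Ψ, fun f => (hΨ (e f)).trans ?_⟩
  change ψ (e.symm (e f)) = ψ f
  rw [e.symm_apply_apply]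

variable (E) in
/-- The Banach space of families of bounded functions with values like those of finitely many
derivatives. -/
def BoundedDerivs (s : Finset (ℕ × ℕ)) : Type _ :=
  ∀ i : s, BoundedContinuousFunction E (E [×i.1.2]→L[ℝ] ℂ)

noncomputable instance (s : Finset (ℕ × ℕ)) : NormedAddCommGroup (BoundedDerivs E s) :=
  inferInstanceAs (NormedAddCommGroup
    (∀ i : s, BoundedContinuousFunction E (E [×i.1.2]→L[ℝ] ℂ)))

noncomputable instance (s : Finset (ℕ × ℕ)) : NormedSpace ℂ (BoundedDerivs E s) :=
  inferInstanceAs (NormedSpace ℂ (∀ i : s, BoundedContinuousFunction E (E [×i.1.2]→L[ℝ] ℂ)))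

instance (s : Finset (ℕ × ℕ)) : CompleteSpace (BoundedDerivs E s) :=
  inferInstanceAs (CompleteSpace (∀ i : s, BoundedContinuousFunction E (E [×i.1.2]→L[ℝ] ℂ)))

/-- Finitely many weighted derivatives of a Schwartz function. -/
noncomputable def SchwartzMap.weightedDerivsCLM (s : Finset (ℕ × ℕ)) :
    𝓢(E, ℂ) →L[ℂ] BoundedDerivs E s :=
  ContinuousLinearMap.pi (φ := fun i : s => BoundedContinuousFunction E (E [×i.1.2]→L[ℝ] ℂ)) fun i => SchwartzMap.weightedDerivCLM i.1.1 i.1.2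

theorem SchwartzMap.weightedDerivsCLM_injective (s : Finset (ℕ × ℕ)) (hs : (0, 0) ∈ s) :
    Function.Injective (SchwartzMap.weightedDerivsCLM (E := E) s) := by
  intro f f' h
  ext t
  have h1 : weightedDerivCLM 0 0 f = weightedDerivCLM 0 0 f' := congrFun h ⟨(0, 0), hs⟩
  have h2 := DFunLike.congr_fun h1 t
  have h3 : iteratedFDeriv ℝ 0 f t = iteratedFDeriv ℝ 0 f' t := by
    simpa [SchwartzMap.weightedDerivCLM_apply_apply] using h2
  simpa using DFunLike.congr_fun h3 0

theorem SchwartzMap.seminorm_le_norm_weightedDerivsCLM {s : Finset (ℕ × ℕ)} {i : ℕ × ℕ}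
    (hi : i ∈ s) (f : 𝓢(E, ℂ)) :
    SchwartzMap.seminorm ℂ i.1 i.2 f ≤ ‖SchwartzMap.weightedDerivsCLM s f‖ :=
  (SchwartzMap.seminorm_le_norm_weightedDerivCLM i.1 i.2 f).trans
    (norm_le_pi_norm (SchwartzMap.weightedDerivsCLM s f) ⟨i, hi⟩)

theorem SchwartzMap.norm_weightedDerivsCLM_le (s : Finset (ℕ × ℕ)) (f : 𝓢(E, ℂ)) :
    ‖SchwartzMap.weightedDerivsCLM s f‖ ≤ ∑ i ∈ s, SchwartzMap.seminorm ℂ i.1 i.2 f := by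
  refine (pi_norm_le_iff_of_nonneg (Finset.sum_nonneg fun i _ => apply_nonneg _ _)).2 fun i => ?_
  exact (SchwartzMap.norm_weightedDerivCLM_le _ _ _).trans
    (Finset.single_le_sum (f := fun i : ℕ × ℕ => SchwartzMap.seminorm ℂ i.1 i.2 f)
      (fun i _ => apply_nonneg _ _) i.2)

theorem SchwartzMap.integrable_weightedDerivsCLM (s : Finset (ℕ × ℕ)) {Φ : Z → 𝓢(E, ℂ)}
    (hΦ : Continuous Φ)
    (hint : ∀ k n, Integrable (fun z => SchwartzMap.seminorm ℂ k n (Φ z)) ν) :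
    Integrable (fun z => SchwartzMap.weightedDerivsCLM s (Φ z)) ν :=
  Integrable.mono' (integrable_finsetSum s fun i _ => hint i.1 i.2)
    ((SchwartzMap.weightedDerivsCLM s).continuous.comp hΦ).aestronglyMeasurable
    (Filter.Eventually.of_forall fun z => SchwartzMap.norm_weightedDerivsCLM_le s (Φ z))

theorem SchwartzMap.weightedDerivsCLM_eq_integral (s : Finset (ℕ × ℕ)) {Φ : Z → 𝓢(E, ℂ)}
    (hΦ : Continuous Φ)
    (hint : ∀ k n, Integrable (fun z => SchwartzMap.seminorm ℂ k n (Φ z)) ν) {h : 𝓢(E, ℂ)}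
    (hh : ∀ t, h t = ∫ z, Φ z t ∂ν) :
    SchwartzMap.weightedDerivsCLM s h = ∫ z, SchwartzMap.weightedDerivsCLM s (Φ z) ∂ν := by
  funext i
  ext1 t
  let L : BoundedDerivs E s →L[ℂ] E [×i.1.2]→L[ℝ] ℂ :=
    (BoundedContinuousFunction.evalCLM ℂ t).comp (ContinuousLinearMap.proj (R := ℂ)
      (φ := fun i : s => BoundedContinuousFunction E (E [×i.1.2]→L[ℝ] ℂ)) i)
  have hL : ∀ f, L (SchwartzMap.weightedDerivsCLM s f)
    = ‖t‖ ^ i.1.1 • iteratedFDeriv ℝ i.1.2 f t := fun f => rfl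
  change L (SchwartzMap.weightedDerivsCLM s h) = L (∫ z, SchwartzMap.weightedDerivsCLM s (Φ z) ∂ν)
  rw [← L.integral_comp_comm (integrable_weightedDerivsCLM s hΦ hint)]
  simp only [hL]
  rw [integral_smul, SchwartzMap.iteratedFDeriv_eq_integral hΦ hint hh]

/-- By continuity `ψ` is bounded by finitely many seminorms, so by Hahn-Banach it factors through
the Banach space of the corresponding weighted derivatives. There the integral is a Bochner integral
and commutes with the functional. -/
theorem TemperedDistribution.apply_eq_integral (ψ : 𝓢'(E, ℂ)) {Φ : Z → 𝓢(E, ℂ)}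
    (hΦ : Continuous Φ)
    (hint : ∀ k n, Integrable (fun z => SchwartzMap.seminorm ℂ k n (Φ z)) ν) {h : 𝓢(E, ℂ)}
    (hh : ∀ t, h t = ∫ z, Φ z t ∂ν) :
    ψ h = ∫ z, ψ (Φ z) ∂ν := by
  obtain ⟨s₀, C, -, hC⟩ := Seminorm.bound_of_continuous (schwartz_withSeminorms ℂ E ℂ)
    ((normSeminorm ℂ ℂ).comp (ψ : 𝓢(E, ℂ) →ₗ[ℂ] ℂ)) (continuous_norm.comp ψ.continuous)
  -- Inserting `(0, 0)` makes the map into the Banach space injective.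
  obtain ⟨Ψ, hΨ⟩ := LinearMap.exists_strongDual_comp_eq (X := BoundedDerivs E (insert (0, 0) s₀))
    (SchwartzMap.weightedDerivsCLM (insert (0, 0) s₀)).toLinearMap
    (SchwartzMap.weightedDerivsCLM_injective _ (Finset.mem_insert_self _ _))
    (ψ : 𝓢(E, ℂ) →ₗ[ℂ] ℂ) C (fun f => by
      refine (hC f).trans ?_
      rw [smul_apply, NNReal.smul_def, smul_eq_mul]
      refine mul_le_mul_of_nonneg_left ?_ C.2
      exact Seminorm.finset_sup_apply_le (norm_nonneg _) fun i hi =>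
        SchwartzMap.seminorm_le_norm_weightedDerivsCLM (Finset.mem_insert_of_mem hi) f)
  have hΨ' : ∀ f, Ψ (SchwartzMap.weightedDerivsCLM (insert (0, 0) s₀) f) = ψ f := hΨ
  rw [← hΨ', SchwartzMap.weightedDerivsCLM_eq_integral _ hΦ hint hh, ← Ψ.integral_comp_comm
    (SchwartzMap.integrable_weightedDerivsCLM _ hΦ hint)]
  simp only [hΨ']

end SchwartzIntegral

/-! ### Continuity and growth of time-frequency shifts on Schwartz space -/

section Translation

open scoped FourierTransform

variable {E : Type*} [NormedAddCommGroup E] [NormedSpace ℝ E]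

theorem SchwartzMap.iteratedFDeriv_compSubConstCLM (n : ℕ) (f : 𝓢(E, ℂ)) (x t : E) :
    iteratedFDeriv ℝ n (f.compSubConstCLM ℂ x) t = iteratedFDeriv ℝ n f (t - x) := by
  have : ⇑(f.compSubConstCLM ℂ x) = fun t => f (t - x) := by ext; simp
  rw [this, iteratedFDeriv_comp_sub]

theorem SchwartzMap.seminorm_compSubConstCLM_le (k n : ℕ) (f : 𝓢(E, ℂ)) (x : E) :
    SchwartzMap.seminorm ℂ k n (f.compSubConstCLM ℂ x)
      ≤ 2 ^ k * (1 + ‖x‖) ^ k * (Finset.Iic (k, n)).sup (schwartzSeminormFamily ℂ E ℂ) f := by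
  refine SchwartzMap.seminorm_le_bound ℂ k n _ (by positivity) fun t => ?_
  rw [iteratedFDeriv_compSubConstCLM]
  have h1 : ‖t‖ ≤ (1 + ‖x‖) * (1 + ‖t - x‖) := by
    have : ‖t‖ ≤ ‖t - x‖ + ‖x‖ := by simpa using norm_add_le (t - x) x
    nlinarith [norm_nonneg x, norm_nonneg (t - x)]
  have h2 := SchwartzMap.one_add_le_sup_seminorm_apply (𝕜 := ℂ) (m := (k, n)) le_rfl le_rfl f
    (t - x)
  calc ‖t‖ ^ k * ‖iteratedFDeriv ℝ n f (t - x)‖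
      ≤ ((1 + ‖x‖) * (1 + ‖t - x‖)) ^ k * ‖iteratedFDeriv ℝ n f (t - x)‖ := by gcongr
    _ = (1 + ‖x‖) ^ k * ((1 + ‖t - x‖) ^ k * ‖iteratedFDeriv ℝ n f (t - x)‖) := by
        rw [mul_pow]; ring
    _ ≤ (1 + ‖x‖) ^ k * (2 ^ k * (Finset.Iic (k, n)).sup (schwartzSeminormFamily ℂ E ℂ) f) :=
        mul_le_mul_of_nonneg_left h2 (by positivity)
    _ = _ := by ring

/-- Mean value inequality on the segment from `t` to `t - x`. As `‖x‖ ≤ 1`, the weights on it are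
comparable up to a factor `2`; one `2 ^ k` comes from this and another from the supremum of
seminorms. -/
theorem SchwartzMap.seminorm_compSubConstCLM_sub_le (k n : ℕ) (f : 𝓢(E, ℂ)) (x : E)
    (hx : ‖x‖ ≤ 1) :
    SchwartzMap.seminorm ℂ k n (f.compSubConstCLM ℂ x - f)
      ≤ 4 ^ k * (Finset.Iic (k, n + 1)).sup (schwartzSeminormFamily ℂ E ℂ) f * ‖x‖ := by
  set S := (Finset.Iic (k, n + 1)).sup (schwartzSeminormFamily ℂ E ℂ) f with hS
  have hS0 : 0 ≤ S := apply_nonneg _ _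
  refine SchwartzMap.seminorm_le_bound ℂ k n _ (by positivity) fun t => ?_
  have e : iteratedFDeriv ℝ n (⇑(f.compSubConstCLM ℂ x - f)) t
      = iteratedFDeriv ℝ n f (t - x) - iteratedFDeriv ℝ n f t := by
    have : ⇑(f.compSubConstCLM ℂ x - f) = ⇑(f.compSubConstCLM ℂ x) - ⇑f := rfl
    rw [this, iteratedFDeriv_sub_apply ((SchwartzMap.smooth _ n).contDiffAt)
      ((f.smooth n).contDiffAt), iteratedFDeriv_compSubConstCLM]
  rw [e]
  have hb : ∀ s ∈ segment ℝ t (t - x),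
      ‖fderiv ℝ (iteratedFDeriv ℝ n f) s‖ ≤ 4 ^ k * S / (1 + ‖t‖) ^ k := by
    intro s hs
    rw [norm_fderiv_iteratedFDeriv, le_div_iff₀ (by positivity)]
    have h1 : ‖t - s‖ ≤ 1 := by
      have := norm_sub_le_of_mem_segment hs
      rw [norm_sub_rev]
      refine this.trans ?_
      simpa using hx
    have h2 : 1 + ‖t‖ ≤ 2 * (1 + ‖s‖) := by
      have : ‖t‖ ≤ ‖t - s‖ + ‖s‖ := by simpa using norm_add_le (t - s) s
      linarith [norm_nonneg s]
    have h3 := SchwartzMap.one_add_le_sup_seminorm_apply (𝕜 := ℂ) (m := (k, n + 1)) le_rfl le_rfl f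
      s
    calc ‖iteratedFDeriv ℝ (n + 1) f s‖ * (1 + ‖t‖) ^ k
        ≤ ‖iteratedFDeriv ℝ (n + 1) f s‖ * (2 * (1 + ‖s‖)) ^ k := by gcongr
      _ = 2 ^ k * ((1 + ‖s‖) ^ k * ‖iteratedFDeriv ℝ (n + 1) f s‖) := by
          rw [mul_pow]; ring
      _ ≤ 2 ^ k * (2 ^ k * S) := mul_le_mul_of_nonneg_left h3 (by positivity)
      _ = 4 ^ k * S := by rw [← mul_assoc, ← mul_pow]; norm_num
  have h4 := (convex_segment t (t - x)).norm_image_sub_le_of_norm_fderiv_le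
    (f := iteratedFDeriv ℝ n f) (𝕜 := ℝ)
    (fun s _ => ((f.smooth (n + 1 : ℕ)).differentiable_iteratedFDeriv
      (by exact_mod_cast Nat.lt_succ_self n) s)) hb (left_mem_segment ℝ _ _)
    (right_mem_segment ℝ _ _)
  have h5 : ‖t - x - t‖ = ‖x‖ := by simp
  rw [h5] at h4
  calc ‖t‖ ^ k * ‖iteratedFDeriv ℝ n f (t - x) - iteratedFDeriv ℝ n f t‖
      ≤ (1 + ‖t‖) ^ k * (4 ^ k * S / (1 + ‖t‖) ^ k * ‖x‖) := by
        gcongr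
        linarith
    _ = 4 ^ k * S * ‖x‖ := by field_simp

/-- Translation `(x, f) ↦ f (· - x)` is jointly continuous on Schwartz space. -/
theorem SchwartzMap.continuous_compSubConstCLM :
    Continuous fun q : E × 𝓢(E, ℂ) => q.2.compSubConstCLM ℂ q.1 := by
  rw [continuous_iff_continuousAt]
  rintro ⟨x₀, f₀⟩
  have hw := schwartz_withSeminorms ℂ E ℂ
  have hsup : ∀ s : Finset (ℕ × ℕ),
      Continuous (s.sup (schwartzSeminormFamily ℂ E ℂ) : Seminorm ℂ 𝓢(E, ℂ)) :=
    fun s => Seminorm.continuous_finsetSup fun i _ => hw.continuous_seminorm i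
  -- With `T_x` for translation, `T_x f - T_{x₀} f₀ = T_x (f - f₀) + T_{x₀} (T_{x - x₀} f₀ - f₀)`;
  -- both terms tend to zero.
  have h1 : Filter.Tendsto (fun q : E × 𝓢(E, ℂ) => (q.2 - f₀).compSubConstCLM ℂ q.1)
      (nhds (x₀, f₀)) (nhds 0) := by
    rw [hw.tendsto_nhds]
    rintro ⟨k, n⟩ ε hε
    have hc : Continuous fun q : E × 𝓢(E, ℂ) => 2 ^ k * (1 + ‖q.1‖) ^ k *
        (Finset.Iic (k, n)).sup (schwartzSeminormFamily ℂ E ℂ) (q.2 - f₀) := by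
      have := (hsup (Finset.Iic (k, n))).comp (continuous_snd.sub continuous_const :
        Continuous fun q : E × 𝓢(E, ℂ) => q.2 - f₀)
      exact Continuous.mul (by fun_prop) this
    have h0 := hc.tendsto (x₀, f₀)
    simp only [sub_self, map_zero, mul_zero] at h0
    filter_upwards [h0.eventually_lt_const hε] with q hq
    rw [sub_zero]
    exact (seminorm_compSubConstCLM_le k n (q.2 - f₀) q.1).trans_lt hq
  have h2 : Filter.Tendsto (fun x : E => f₀.compSubConstCLM ℂ x - f₀) (nhds 0) (nhds 0) := by
    rw [hw.tendsto_nhds]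
    rintro ⟨k, n⟩ ε hε
    have hc : Continuous fun x : E => 4 ^ k *
        (Finset.Iic (k, n + 1)).sup (schwartzSeminormFamily ℂ E ℂ) f₀ * ‖x‖ := by fun_prop
    have h0 := hc.tendsto 0
    simp only [norm_zero, mul_zero] at h0
    filter_upwards [h0.eventually_lt_const hε, Metric.closedBall_mem_nhds 0 one_pos] with x hx hx1
    rw [sub_zero]
    exact (seminorm_compSubConstCLM_sub_le k n f₀ x (by simpa using hx1)).trans_lt hx
  have h3 : Filter.Tendsto (fun q : E × 𝓢(E, ℂ) => q.1 - x₀) (nhds (x₀, f₀)) (nhds 0) := by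
    have : Continuous fun q : E × 𝓢(E, ℂ) => q.1 - x₀ := by fun_prop
    simpa using this.tendsto (x₀, f₀)
  have h4 := ((SchwartzMap.compSubConstCLM (F := ℂ) ℂ x₀).continuous.tendsto 0).comp (h2.comp h3)
  rw [map_zero] at h4
  have h5 := (h1.add h4).add_const (f₀.compSubConstCLM ℂ x₀)
  simp only [zero_add] at h5
  refine h5.congr fun q => ?_
  ext t
  simp

/-- A curve in Schwartz space all of whose seminorms grow at most polynomially. -/
def SchwartzMap.PolynomiallyBounded {Z : Type*} [Norm Z] (Φ : Z → 𝓢(E, ℂ)) : Prop :=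
  ∀ i : ℕ × ℕ, ∃ (C : ℝ) (N : ℕ), ∀ z, schwartzSeminormFamily ℂ E ℂ i (Φ z) ≤ C * (1 + ‖z‖) ^ N

namespace SchwartzMap.PolynomiallyBounded

variable {Z : Type*} [SeminormedAddCommGroup Z] {Φ : Z → 𝓢(E, ℂ)}

theorem const (f : 𝓢(E, ℂ)) : PolynomiallyBounded fun _ : Z => f :=
  fun i => ⟨schwartzSeminormFamily ℂ E ℂ i f, 0, fun z => by simp⟩

theorem finset_sup (hΦ : PolynomiallyBounded Φ) (s : Finset (ℕ × ℕ)) :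
    ∃ (C : ℝ) (N : ℕ), ∀ z, s.sup (schwartzSeminormFamily ℂ E ℂ) (Φ z) ≤ C * (1 + ‖z‖) ^ N := by
  choose C N h using hΦ
  refine ⟨∑ i ∈ s, |C i|, ∑ i ∈ s, N i, fun z => ?_⟩
  refine Seminorm.finset_sup_apply_le (by positivity) fun i hi => (h i z).trans ?_
  have h1 : (1 : ℝ) ≤ 1 + ‖z‖ := by linarith [norm_nonneg z]
  gcongr
  · exact (le_abs_self _).trans
      (Finset.single_le_sum (f := fun i => |C i|) (fun _ _ => abs_nonneg _) hi)
  · exact Finset.single_le_sum (f := N) (fun _ _ => Nat.zero_le _) hi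

theorem seminorm (hΦ : PolynomiallyBounded Φ) (p : Seminorm ℂ 𝓢(E, ℂ)) (hp : Continuous p) :
    ∃ (C : ℝ) (N : ℕ), ∀ z, p (Φ z) ≤ C * (1 + ‖z‖) ^ N := by
  obtain ⟨s, C', -, hC'⟩ := Seminorm.bound_of_continuous (schwartz_withSeminorms ℂ E ℂ) p hp
  obtain ⟨C, N, h⟩ := hΦ.finset_sup s
  refine ⟨C' * C, N, fun z => (hC' (Φ z)).trans ?_⟩
  rw [smul_apply, NNReal.smul_def, smul_eq_mul, mul_assoc]
  exact mul_le_mul_of_nonneg_left (h z) C'.2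

theorem clm (hΦ : PolynomiallyBounded Φ) (L : 𝓢(E, ℂ) →L[ℂ] 𝓢(E, ℂ)) :
    PolynomiallyBounded fun z => L (Φ z) := fun i =>
  hΦ.seminorm ((schwartzSeminormFamily ℂ E ℂ i).comp L.toLinearMap)
    (((schwartz_withSeminorms ℂ E ℂ).continuous_seminorm i).comp L.continuous)

theorem compSubConst (hΦ : PolynomiallyBounded Φ) (a : Z → E) (ha : ∀ z, ‖a z‖ ≤ ‖z‖) :
    PolynomiallyBounded fun z => (Φ z).compSubConstCLM ℂ (a z) := by
  rintro ⟨k, n⟩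
  obtain ⟨C, N, h⟩ := hΦ.finset_sup (Finset.Iic (k, n))
  refine ⟨2 ^ k * C, k + N, fun z => ?_⟩
  calc schwartzSeminormFamily ℂ E ℂ (k, n) ((Φ z).compSubConstCLM ℂ (a z))
      ≤ 2 ^ k * (1 + ‖a z‖) ^ k * (Finset.Iic (k, n)).sup (schwartzSeminormFamily ℂ E ℂ) (Φ z) :=
        seminorm_compSubConstCLM_le k n (Φ z) (a z)
    _ ≤ 2 ^ k * (1 + ‖z‖) ^ k * (C * (1 + ‖z‖) ^ N) := by
        gcongr
        · exact ha z
        · exact h z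
    _ = 2 ^ k * C * (1 + ‖z‖) ^ (k + N) := by ring

end SchwartzMap.PolynomiallyBounded

end Translation

/-! ### Time-frequency shifts and the short-time Fourier transform -/

section TimeFrequency

open scoped FourierTransform

variable {d : ℕ}

theorem tfCharConj_eq_fourierChar (ω t : TFSpace d) :
    tfCharConj ω t = (Real.fourierChar (-inner ℝ t ω) : ℂ) := by
  rw [tfCharConj, Real.fourierChar_apply, real_inner_comm]
  congr 1
  push_cast
  ring

theorem norm_tfCharConj (ω t : TFSpace d) : ‖tfCharConj ω t‖ = 1 := by
  rw [tfCharConj_eq_fourierChar]; exact Circle.norm_coe _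

theorem tfCharConj_add_left (ω η t : TFSpace d) :
    tfCharConj (ω + η) t = tfCharConj ω t * tfCharConj η t := by
  simp only [tfCharConj, ← Complex.exp_add, inner_add_left]
  congr 1; push_cast; ring

theorem tfCharConj_add_right (ω s t : TFSpace d) :
    tfCharConj ω (s + t) = tfCharConj ω s * tfCharConj ω t := by
  simp only [tfCharConj, ← Complex.exp_add, inner_add_right]
  congr 1; push_cast; ring

theorem tfCharConj_neg_left (ω t : TFSpace d) :
    tfCharConj (-ω) t = starRingEnd ℂ (tfCharConj ω t) := by
  simp only [tfCharConj, ← Complex.exp_conj, inner_neg_left]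
  congr 1
  rw [map_mul, Complex.conj_I, map_neg, Complex.conj_ofReal]
  push_cast; ring

theorem tfCharConj_neg_right (ω t : TFSpace d) :
    tfCharConj ω (-t) = starRingEnd ℂ (tfCharConj ω t) := by
  rw [← tfCharConj_neg_left, tfCharConj, tfCharConj, inner_neg_left, inner_neg_right]

theorem tfCharConj_comm (ω t : TFSpace d) : tfCharConj ω t = tfCharConj t ω := by
  rw [tfCharConj, tfCharConj, real_inner_comm]

theorem continuous_tfCharConj : Continuous fun q : TFSpace d × TFSpace d => tfCharConj q.1 q.2 := by
  unfold tfCharConj; fun_prop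

theorem fourier_apply_eq_integral_tfCharConj (f : TFSpace d → ℂ) (ω : TFSpace d) :
    𝓕 f ω = ∫ t, f t * tfCharConj ω t := by
  rw [Real.fourier_eq]
  refine integral_congr_ae (Filter.Eventually.of_forall fun t => ?_)
  simp only [Circle.smul_def, smul_eq_mul, tfCharConj_eq_fourierChar]
  ring

theorem fourierInv_apply_eq_integral_tfCharConj (f : TFSpace d → ℂ) (ω : TFSpace d) :
    𝓕⁻ f ω = ∫ t, f t * starRingEnd ℂ (tfCharConj ω t) := by
  rw [Real.fourierInv_eq_fourier_neg, fourier_apply_eq_integral_tfCharConj]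
  simp only [tfCharConj_neg_left]

theorem stft_eq_fourier (φ f : TFSpace d → ℂ) (z : TFPlane d) :
    stft φ f z = 𝓕 (fun t => f t * starRingEnd ℂ (φ (t - z.1))) z.2 := by
  rw [fourier_apply_eq_integral_tfCharConj]; rfl

/-- The time-frequency shift `π(z) f (t) = exp (2πi ω·t) f (t - x)` for `z = (x, ω)`. -/
noncomputable def tfShift (z : TFPlane d) (f : TFSpace d → ℂ) (t : TFSpace d) : ℂ :=
  starRingEnd ℂ (tfCharConj z.2 t) * f (t - z.1)

/-- Covariance: translating the integration variable moves the shift to the argument, up to a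
unimodular phase. -/
theorem norm_stft_tfShift (φ f : TFSpace d → ℂ) (w z : TFPlane d) :
    ‖stft φ (tfShift w f) z‖ = ‖stft φ f (z - w)‖ := by
  have : stft φ (tfShift w f) z
      = starRingEnd ℂ (tfCharConj w.2 w.1) * tfCharConj z.2 w.1 * stft φ f (z - w) := by
    rw [stft, stft, ← integral_const_mul, ← integral_add_right_eq_self _ w.1]
    refine integral_congr_ae (Filter.Eventually.of_forall fun t => ?_)
    have h1 : t + w.1 - z.1 = t - (z.1 - w.1) := by abel
    simp only [tfShift, add_sub_cancel_right, tfCharConj_add_right, map_mul, Prod.fst_sub,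
      Prod.snd_sub, sub_eq_add_neg z.2, tfCharConj_add_left, tfCharConj_neg_left, h1]
    ring
  rw [this, norm_mul, norm_mul, RCLike.norm_conj, norm_tfCharConj, norm_tfCharConj, one_mul,
    one_mul]

theorem norm_stft_neg (φ f : TFSpace d → ℂ) (z : TFPlane d) :
    ‖stft φ f (-z)‖ = ‖stft f φ z‖ := by
  have : stft φ f (-z) = tfCharConj z.2 z.1 * starRingEnd ℂ (stft f φ z) := by
    rw [stft, stft, ← integral_conj, ← integral_const_mul, ← integral_sub_right_eq_self _ z.1]
    refine integral_congr_ae (Filter.Eventually.of_forall fun t => ?_)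
    have h1 : t + -z.1 - (-z).1 = t := by simp
    simp only [sub_eq_add_neg t, h1, map_mul, starRingEnd_self_apply, Prod.snd_neg,
      tfCharConj_add_right, tfCharConj_neg_left, tfCharConj_neg_right]
    ring
  rw [this, norm_mul, norm_tfCharConj, RCLike.norm_conj, one_mul]

theorem norm_stft_sub_comm (φ f : TFSpace d → ℂ) (w z : TFPlane d) :
    ‖stft φ f (z - w)‖ = ‖stft f φ (w - z)‖ := by
  rw [← norm_stft_neg, neg_sub]

/-- The complex conjugate of a Schwartz function. -/
noncomputable def SchwartzMap.conj (g : 𝓢(TFSpace d, ℂ)) : 𝓢(TFSpace d, ℂ) :=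
  g.postcompCLM (Complex.conjCLE : ℂ →L[ℝ] ℂ)

theorem SchwartzMap.conj_apply (g : 𝓢(TFSpace d, ℂ)) (t : TFSpace d) :
    g.conj t = starRingEnd ℂ (g t) := by
  simp [SchwartzMap.conj]

theorem fourier_tfShiftConj_apply (g : 𝓢(TFSpace d, ℂ)) (z : TFPlane d) (ξ : TFSpace d) :
    𝓕 (tfShiftConj g z) ξ = 𝓕 (g.conj.compSubConstCLM ℂ z.1) (ξ + z.2) := by
  rw [SchwartzMap.fourier_coe, SchwartzMap.fourier_coe, fourier_apply_eq_integral_tfCharConj,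
    fourier_apply_eq_integral_tfCharConj]
  refine integral_congr_ae (Filter.Eventually.of_forall fun t => ?_)
  simp only [tfShiftConj_apply, SchwartzMap.compSubConstCLM_apply, SchwartzMap.conj_apply,
    tfCharConj_add_left]
  ring

theorem norm_fourier_compSubConstCLM_apply (v : 𝓢(TFSpace d, ℂ)) (x ξ : TFSpace d) :
    ‖𝓕 (v.compSubConstCLM ℂ x) ξ‖ = ‖𝓕 v ξ‖ := by
  have : 𝓕 (v.compSubConstCLM ℂ x) ξ = tfCharConj ξ x * 𝓕 v ξ := by
    rw [SchwartzMap.fourier_coe, SchwartzMap.fourier_coe, fourier_apply_eq_integral_tfCharConj,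
      fourier_apply_eq_integral_tfCharConj, ← integral_const_mul,
      ← integral_add_right_eq_self _ x]
    refine integral_congr_ae (Filter.Eventually.of_forall fun t => ?_)
    simp only [SchwartzMap.compSubConstCLM_apply, add_sub_cancel_right, tfCharConj_add_right]
    ring
  rw [this, norm_mul, norm_tfCharConj, one_mul]

/-- Modulation is translation on the Fourier side. Continuity and polynomial growth in `z` thus
reduce to those of translations, because the Fourier transform is continuous on Schwartz space. -/
theorem tfShiftConj_eq_fourierInv (g : 𝓢(TFSpace d, ℂ)) (z : TFPlane d) :
    tfShiftConj g z = 𝓕⁻ ((𝓕 (g.conj.compSubConstCLM ℂ z.1)).compSubConstCLM ℂ (-z.2)) := by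
  rw [← FourierTransform.fourierInv_fourier_eq (F := 𝓢(TFSpace d, ℂ)) (tfShiftConj g z)]
  congr 1
  ext ξ
  rw [fourier_tfShiftConj_apply, SchwartzMap.compSubConstCLM_apply, sub_neg_eq_add]

theorem continuous_tfShiftConj (g : 𝓢(TFSpace d, ℂ)) : Continuous (tfShiftConj g) := by
  have h1 : Continuous fun z : TFPlane d => 𝓕 (g.conj.compSubConstCLM ℂ z.1) :=
    (FourierTransform.fourierCLM ℂ 𝓢(TFSpace d, ℂ)).continuous.comp
      (SchwartzMap.continuous_compSubConstCLM.comp (continuous_fst.prodMk continuous_const))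
  have h2 : Continuous fun z : TFPlane d =>
      𝓕⁻ ((𝓕 (g.conj.compSubConstCLM ℂ z.1)).compSubConstCLM ℂ (-z.2)) :=
    (FourierTransform.fourierInvCLM ℂ 𝓢(TFSpace d, ℂ)).continuous.comp
      (SchwartzMap.continuous_compSubConstCLM.comp (continuous_snd.neg.prodMk h1))
  exact h2.congr fun z => (tfShiftConj_eq_fourierInv g z).symm

theorem polynomiallyBounded_tfShiftConj (g : 𝓢(TFSpace d, ℂ)) :
    SchwartzMap.PolynomiallyBounded (tfShiftConj g) := by
  have h := (((((SchwartzMap.PolynomiallyBounded.const (Z := TFPlane d) g.conj).compSubConst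
    (fun z => z.1) (fun z => norm_fst_le z)).clm
    (FourierTransform.fourierCLM ℂ 𝓢(TFSpace d, ℂ))).compSubConst
    (fun z => -z.2) (fun z => by rw [norm_neg]; exact norm_snd_le z)).clm
    (FourierTransform.fourierInvCLM ℂ 𝓢(TFSpace d, ℂ)))
  have e : tfShiftConj g = fun z : TFPlane d =>
      𝓕⁻ ((𝓕 (g.conj.compSubConstCLM ℂ z.1)).compSubConstCLM ℂ (-z.2)) :=
    funext (tfShiftConj_eq_fourierInv g)
  rw [e]
  exact h

theorem continuous_stftDistribution (g : 𝓢(TFSpace d, ℂ)) (ψ : 𝓢'(TFSpace d, ℂ)) :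
    Continuous (stftDistribution g ψ) :=
  ψ.continuous.comp (continuous_tfShiftConj g)

theorem stft_schwartz_eq_integral_mul_tfShiftConj (g h : 𝓢(TFSpace d, ℂ)) (z : TFPlane d) :
    stft g h z = ∫ t, h t * tfShiftConj g z t := by
  rw [stft]
  refine integral_congr_ae (Filter.Eventually.of_forall fun t => ?_)
  simp only [tfShiftConj_apply]
  ring

/-! ### Decay of the short-time Fourier transform of a Schwartz function -/

theorem integrable_one_add_norm_pow_mul_norm_of_decay {Z : Type*} [NormedAddCommGroup Z]
    [NormedSpace ℝ Z] [FiniteDimensional ℝ Z] [MeasureSpace Z] [BorelSpace Z]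
    [(volume : Measure Z).IsAddHaarMeasure] {F : Z → ℂ} (hF : Continuous F)
    (h : ∀ N : ℕ, ∃ C : ℝ, ∀ z, (1 + ‖z‖) ^ N * ‖F z‖ ≤ C) (N : ℕ) :
    Integrable (fun z => (1 + ‖z‖) ^ N * ‖F z‖) volume := by
  -- The `dim + 1` extra powers leave an integrable majorant.
  obtain ⟨C, hC⟩ := h (N + (Module.finrank ℝ Z + 1))
  have hr : (Module.finrank ℝ Z : ℝ) < ((Module.finrank ℝ Z + 1 : ℕ) : ℝ) := by
    exact_mod_cast Nat.lt_succ_self _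
  refine ((integrable_one_add_norm (μ := (volume : Measure Z)) hr).const_mul C).mono'
    (by fun_prop) (Filter.Eventually.of_forall fun z => ?_)
  have h1 : 0 < 1 + ‖z‖ := by positivity
  rw [Real.norm_of_nonneg (by positivity), Real.rpow_neg h1.le, Real.rpow_natCast,
    ← div_eq_mul_inv, le_div_iff₀ (by positivity)]
  refine le_trans (le_of_eq ?_) (hC z)
  rw [pow_add]; ring

theorem SchwartzMap.exists_one_add_norm_pow_mul_norm_le (v : 𝓢(TFSpace d, ℂ)) (N : ℕ) :
    ∃ C : ℝ, 0 ≤ C ∧ ∀ t, (1 + ‖t‖) ^ N * ‖v t‖ ≤ C := by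
  refine ⟨2 ^ N * (Finset.Iic (N, 0)).sup (schwartzSeminormFamily ℂ _ ℂ) v, by positivity,
    fun t => ?_⟩
  have := SchwartzMap.one_add_le_sup_seminorm_apply (𝕜 := ℂ) (m := (N, 0)) le_rfl le_rfl v t
  rwa [norm_iteratedFDeriv_zero] at this

theorem SchwartzMap.integrable_one_add_norm_pow_mul_norm (u : 𝓢(TFSpace d, ℂ)) (N : ℕ) :
    Integrable (fun t => (1 + ‖t‖) ^ N * ‖u t‖) volume :=
  integrable_one_add_norm_pow_mul_norm_of_decay u.continuous
    (fun N => (u.exists_one_add_norm_pow_mul_norm_le N).imp fun _ h => h.2) N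

theorem SchwartzMap.exists_one_add_norm_pow_mul_integral_le (u v : 𝓢(TFSpace d, ℂ)) (N : ℕ) :
    ∃ C : ℝ, ∀ a : TFSpace d, (1 + ‖a‖) ^ N * ∫ t, ‖u t‖ * ‖v (t - a)‖ ≤ C := by
  obtain ⟨C, hC0, hC⟩ := v.exists_one_add_norm_pow_mul_norm_le N
  refine ⟨(∫ t, (1 + ‖t‖) ^ N * ‖u t‖) * C, fun a => ?_⟩
  rw [← integral_const_mul, ← integral_mul_const]
  refine integral_mono_of_nonneg (Filter.Eventually.of_forall fun t => by positivity)
    ((u.integrable_one_add_norm_pow_mul_norm N).mul_const C)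
    (Filter.Eventually.of_forall fun t => ?_)
  have h1 : 1 + ‖a‖ ≤ (1 + ‖t‖) * (1 + ‖t - a‖) := by
    have : ‖a‖ ≤ ‖t‖ + ‖t - a‖ := by
      have := norm_sub_le t (t - a)
      simpa using this
    nlinarith [norm_nonneg t, norm_nonneg (t - a)]
  calc (1 + ‖a‖) ^ N * (‖u t‖ * ‖v (t - a)‖)
      ≤ ((1 + ‖t‖) * (1 + ‖t - a‖)) ^ N * (‖u t‖ * ‖v (t - a)‖) := by gcongr
    _ = ((1 + ‖t‖) ^ N * ‖u t‖) * ((1 + ‖t - a‖) ^ N * ‖v (t - a)‖) := by rw [mul_pow]; ring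
    _ ≤ ((1 + ‖t‖) ^ N * ‖u t‖) * C := by gcongr; exact hC _

theorem norm_stft_schwartz_le_fst (g h : 𝓢(TFSpace d, ℂ)) (z : TFPlane d) :
    ‖stft g h z‖ ≤ ∫ t, ‖h t‖ * ‖g (t - z.1)‖ := by
  refine (norm_integral_le_integral_norm _).trans (le_of_eq ?_)
  refine integral_congr_ae (Filter.Eventually.of_forall fun t => ?_)
  simp only [norm_mul, RCLike.norm_conj, norm_tfCharConj, mul_one]

/-- Shifting the Fourier transform from one factor to the other turns the modulation into a
translation, which gives decay in the frequency variable. -/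
theorem norm_stft_schwartz_le_snd (g h : 𝓢(TFSpace d, ℂ)) (z : TFPlane d) :
    ‖stft g h z‖ ≤ ∫ ξ, ‖𝓕⁻ h ξ‖ * ‖𝓕 g.conj (ξ - -z.2)‖ := by
  rw [stft_schwartz_eq_integral_mul_tfShiftConj]
  have := SchwartzMap.integral_fourier_mul_eq (𝓕⁻ h) (tfShiftConj g z)
  rw [FourierTransform.fourier_fourierInv_eq] at this
  rw [this]
  refine (norm_integral_le_integral_norm _).trans (le_of_eq ?_)
  refine integral_congr_ae (Filter.Eventually.of_forall fun t => ?_)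
  simp only [norm_mul, fourier_tfShiftConj_apply, norm_fourier_compSubConstCLM_apply,
    sub_neg_eq_add]

theorem exists_one_add_norm_pow_mul_norm_stft_le (g h : 𝓢(TFSpace d, ℂ)) (N : ℕ) :
    ∃ C : ℝ, ∀ z, (1 + ‖z‖) ^ N * ‖stft g h z‖ ≤ C := by
  obtain ⟨C₁, h₁⟩ := h.exists_one_add_norm_pow_mul_integral_le g N
  obtain ⟨C₂, h₂⟩ := (𝓕⁻ h).exists_one_add_norm_pow_mul_integral_le (𝓕 g.conj) N
  refine ⟨max C₁ C₂, fun z => ?_⟩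
  -- The product carries the maximum norm, so decay in position and in frequency may be proved
  -- separately.
  rw [Prod.norm_def]
  rcases max_cases ‖z.1‖ ‖z.2‖ with ⟨e, -⟩ | ⟨e, -⟩ <;> rw [e]
  · refine le_max_of_le_left (le_trans ?_ (h₁ z.1))
    gcongr
    exact norm_stft_schwartz_le_fst g h z
  · refine le_max_of_le_right (le_trans ?_ (h₂ (-z.2)))
    rw [norm_neg]
    gcongr
    exact norm_stft_schwartz_le_snd g h z

theorem continuous_stft_schwartz (g h : 𝓢(TFSpace d, ℂ)) : Continuous (stft g h) := by
  refine (continuous_stftDistribution g (Lp.toTemperedDistribution (h.toLp 2))).congr fun z => ?_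
  rw [stftDistribution_toTemperedDistribution, stft, stft]
  refine integral_congr_ae ?_
  filter_upwards [h.coeFn_toLp 2 volume] with t ht
  rw [ht]

instance isAddHaarMeasure_volume_tfPlane :
    (volume : Measure (TFPlane d)).IsAddHaarMeasure :=
  Measure.prod.instIsAddHaarMeasure _ _

instance isNegInvariant_volume_tfPlane : (volume : Measure (TFPlane d)).IsNegInvariant :=
  Measure.IsAddHaarMeasure.isNegInvariant_of_regular (volume : Measure (TFPlane d))

theorem integrable_one_add_norm_pow_mul_norm_stft (g h : 𝓢(TFSpace d, ℂ)) (N : ℕ) :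
    Integrable (fun z => (1 + ‖z‖) ^ N * ‖stft g h z‖) volume :=
  integrable_one_add_norm_pow_mul_norm_of_decay (continuous_stft_schwartz g h)
    (exists_one_add_norm_pow_mul_norm_stft_le g h) N

/-! ### The inversion formula for tempered distributions -/

/-- Fourier inversion for fixed `x`: the conjugated transform is the inverse Fourier transform of `h
· g(· - x)`. Conjugating `h` compensates for the pairing with a distribution being bilinear. -/
theorem integral_stft_inversion_inner (g h : 𝓢(TFSpace d, ℂ)) (x t : TFSpace d) :
    ∫ ω, starRingEnd ℂ (stft g h.conj (x, ω)) * tfCharConj ω t = h t * g (t - x) := by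
  set u : 𝓢(TFSpace d, ℂ) :=
    SchwartzMap.pairing (ContinuousLinearMap.mul ℂ ℂ) h (g.compSubConstCLM ℂ x) with hu
  have hu' : ∀ s, u s = h s * g (s - x) := fun s => by
    simp [hu]
  have h1 : ∀ ω, starRingEnd ℂ (stft g h.conj (x, ω)) = 𝓕⁻ u ω := by
    intro ω
    rw [SchwartzMap.fourierInv_coe, fourierInv_apply_eq_integral_tfCharConj, stft, ← integral_conj]
    refine integral_congr_ae (Filter.Eventually.of_forall fun s => ?_)
    simp only [map_mul, SchwartzMap.conj_apply, starRingEnd_self_apply, hu']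
  simp only [h1, tfCharConj_comm _ t]
  rw [← hu', ← fourier_apply_eq_integral_tfCharConj, ← SchwartzMap.fourier_coe,
    FourierTransform.fourier_fourierInv_eq]

theorem integrable_norm_stft_mul_seminorm_tfShiftConj (g h : 𝓢(TFSpace d, ℂ))
    (p : Seminorm ℂ 𝓢(TFSpace d, ℂ)) (hp : Continuous p) :
    Integrable (fun z => ‖stft g h z‖ * p (tfShiftConj g z)) volume := by
  obtain ⟨C, N, hC⟩ := (polynomiallyBounded_tfShiftConj g).seminorm p hp
  refine ((integrable_one_add_norm_pow_mul_norm_stft g h N).const_mul C).mono' ?_ ?_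
  · exact ((continuous_stft_schwartz g h).norm.mul
      (hp.comp (continuous_tfShiftConj g))).aestronglyMeasurable
  · refine Filter.Eventually.of_forall fun z => ?_
    rw [Real.norm_of_nonneg (mul_nonneg (norm_nonneg _) (apply_nonneg _ _))]
    calc _ ≤ ‖stft g h z‖ * (C * (1 + ‖z‖) ^ N) := by gcongr; exact hC z
      _ = _ := by ring

theorem integral_stft_inversion (g h : 𝓢(TFSpace d, ℂ)) (t : TFSpace d) :
    ∫ z, starRingEnd ℂ (stft g h.conj z) * tfShiftConj g z t
      = h t * ∫ s, ((‖g s‖ ^ 2 : ℝ) : ℂ) := by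
  have hint : Integrable (fun z => starRingEnd ℂ (stft g h.conj z) * tfShiftConj g z t)
      (volume.prod volume) := by
    have h1 := integrable_norm_stft_mul_seminorm_tfShiftConj g h.conj
      (SchwartzMap.seminorm ℂ 0 0) ((schwartz_withSeminorms ℂ _ ℂ).continuous_seminorm (0, 0))
    refine h1.mono' ?_ (Filter.Eventually.of_forall fun z => ?_)
    · refine Continuous.aestronglyMeasurable ?_
      refine (Complex.continuous_conj.comp (continuous_stft_schwartz g h.conj)).mul ?_
      simp only [tfShiftConj_apply]
      exact (continuous_tfCharConj.comp (continuous_snd.prodMk continuous_const)).mul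
        (Complex.continuous_conj.comp (g.continuous.comp (continuous_const.sub continuous_fst)))
    · rw [norm_mul, RCLike.norm_conj]
      gcongr
      exact (tfShiftConj g z).norm_le_seminorm ℂ t
  rw [Measure.volume_eq_prod, integral_prod _ hint]
  have h2 : ∀ x, ∫ ω, starRingEnd ℂ (stft g h.conj (x, ω)) * tfShiftConj g (x, ω) t
      = h t * ((‖g (t - x)‖ ^ 2 : ℝ) : ℂ) := by
    intro x
    simp only [tfShiftConj_apply, ← mul_assoc]
    rw [integral_mul_const, integral_stft_inversion_inner, mul_assoc, Complex.mul_conj,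
      Complex.normSq_eq_norm_sq]
  simp only [h2]
  rw [integral_const_mul, integral_sub_left_eq_self (fun s => ((‖g s‖ ^ 2 : ℝ) : ℂ)) volume t]

/-- The inversion formula for the short-time Fourier transform of a tempered distribution. -/
theorem TemperedDistribution.mul_integral_norm_sq_eq (g h : 𝓢(TFSpace d, ℂ))
    (ψ : 𝓢'(TFSpace d, ℂ)) :
    ((∫ s, ‖g s‖ ^ 2 : ℝ) : ℂ) * ψ h
      = ∫ z, starRingEnd ℂ (stft g h.conj z) * stftDistribution g ψ z := by
  have hc : Continuous fun z => starRingEnd ℂ (stft g h.conj z) • tfShiftConj g z :=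
    (Complex.continuous_conj.comp (continuous_stft_schwartz g h.conj)).smul
      (continuous_tfShiftConj g)
  -- Rapid decay of the coefficient outweighs the polynomial growth of the seminorms of the shifts.
  have := TemperedDistribution.apply_eq_integral (ν := volume) ψ hc (fun k n => by
    refine (integrable_norm_stft_mul_seminorm_tfShiftConj g h.conj _
      ((schwartz_withSeminorms ℂ _ ℂ).continuous_seminorm (k, n))).congr
      (Filter.Eventually.of_forall fun z => ?_)
    simp only [map_smul_eq_mul, RCLike.norm_conj]
    rfl) (h := ((∫ s, ‖g s‖ ^ 2 : ℝ) : ℂ) • h) (fun t => by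
      simp only [smul_apply, smul_eq_mul]
      rw [integral_stft_inversion, ← integral_complex_ofReal, mul_comm])
  rw [map_smul, smul_eq_mul] at this
  rw [this]
  simp only [map_smul, smul_eq_mul]
  rfl

/-- The inversion formula tested on `tfShiftConj g w`: the conjugate of this test function is
`π(w)g`, and covariance makes the kernel a convolution kernel. -/
theorem enorm_stftDistribution_le (g : 𝓢(TFSpace d, ℂ)) (ψ : 𝓢'(TFSpace d, ℂ)) (w : TFPlane d) :
    ENNReal.ofReal (∫ s, ‖g s‖ ^ 2) * ‖stftDistribution g ψ w‖ₑ
      ≤ ∫⁻ z, ‖stft g g (w - z)‖ₑ * ‖stftDistribution g ψ z‖ₑ := by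
  have h0 : 0 ≤ ∫ s, ‖g s‖ ^ 2 := integral_nonneg fun s => by positivity
  have h1 := congrArg (fun c : ℂ => ‖c‖ₑ)
    (TemperedDistribution.mul_integral_norm_sq_eq g (tfShiftConj g w) ψ)
  simp only [enorm_mul] at h1
  rw [← ofReal_norm ((∫ s, ‖g s‖ ^ 2 : ℝ) : ℂ), Complex.norm_real,
    Real.norm_of_nonneg h0] at h1
  refine h1.le.trans ((enorm_integral_le_lintegral_enorm _).trans (le_of_eq ?_))
  refine lintegral_congr fun z => ?_
  have h2 : ⇑(tfShiftConj g w).conj = tfShift w g := by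
    funext t
    simp [SchwartzMap.conj_apply, tfShiftConj_apply, tfShift]
  rw [enorm_mul, RCLike.enorm_conj, h2, ← ofReal_norm (stft _ _ z), norm_stft_tfShift,
    norm_stft_sub_comm, ofReal_norm]

theorem MeasureTheory.Integrable.memLp_of_bound {α F : Type*} [MeasurableSpace α]
    [NormedAddCommGroup F] {μ : Measure α} {f : α → F} (hf : Integrable f μ) {C : ℝ}
    (hC : ∀ x, ‖f x‖ ≤ C) {p : ℝ≥0∞} (hp : 1 ≤ p) : MemLp f p μ := by
  rcases eq_or_ne p ∞ with rfl | hpt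
  · exact memLp_top_of_bound hf.1 C (Filter.Eventually.of_forall hC)
  have hq : 1 ≤ p.toReal := by
    have := ENNReal.toReal_mono hpt hp; simpa using this
  rw [← integrable_norm_rpow_iff hf.1 (zero_lt_one.trans_le hp).ne' hpt]
  refine (hf.norm.const_mul (C ^ (p.toReal - 1))).mono'
    (hf.1.norm.aemeasurable.pow_const _).aestronglyMeasurable
    (Filter.Eventually.of_forall fun x => ?_)
  rw [Real.norm_of_nonneg (by positivity)]
  calc ‖f x‖ ^ p.toReal = ‖f x‖ ^ (p.toReal - 1) * ‖f x‖ ^ (1 : ℝ) := by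
        rw [← Real.rpow_add_of_nonneg (norm_nonneg _) (by linarith) zero_le_one, sub_add_cancel]
    _ ≤ C ^ (p.toReal - 1) * ‖f x‖ := by
        rw [Real.rpow_one]
        exact mul_le_mul_of_nonneg_right
          (Real.rpow_le_rpow (norm_nonneg _) (hC x) (by linarith)) (norm_nonneg _)

theorem memLp_stft_schwartz (g h : 𝓢(TFSpace d, ℂ)) (p : ℝ≥0∞) (hp : 1 ≤ p) :
    MemLp (stft g h) p volume := by
  have hm := (continuous_stft_schwartz g h).aestronglyMeasurable (μ := volume)
  have h1 : Integrable (stft g h) volume := by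
    rw [← integrable_norm_iff hm]
    simpa using integrable_one_add_norm_pow_mul_norm_stft g h 0
  obtain ⟨C, hC⟩ := exists_one_add_norm_pow_mul_norm_stft_le g h 0
  exact h1.memLp_of_bound (C := C) (fun z => by simpa using hC z) hp

end TimeFrequency

/-! ### Convolution inequalities -/

/-- Interpolation between `L^p` and `L^∞`, from `f² ≤ M ^ (2 - p) f ^ p`. -/
theorem eLpNorm_two_le_of_le {Z : Type*} [MeasurableSpace Z] {ν : Measure Z} {f : Z → ℝ≥0∞}
    (hf : Measurable f) {M : ℝ≥0∞} (hM : ∀ x, f x ≤ M) {p : ℝ≥0∞}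
    (hp : 1 ≤ p) (hp' : p ≤ 2) :
    eLpNorm f 2 ν ≤ M ^ (1 - p.toReal / 2) * eLpNorm f p ν ^ (p.toReal / 2) := by
  have hpt : p ≠ ∞ := ne_top_of_le_ne_top ENNReal.ofNat_ne_top hp'
  have hq : 1 ≤ p.toReal := by
    have := ENNReal.toReal_mono hpt hp; simpa using this
  have hq2 : p.toReal ≤ 2 := by
    have := ENNReal.toReal_mono ENNReal.ofNat_ne_top hp'; simpa using this
  have hp0 : p ≠ 0 := (zero_lt_one.trans_le hp).ne'
  rw [eLpNorm_eq_lintegral_rpow_enorm_toReal hp0 hpt,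
    eLpNorm_eq_lintegral_rpow_enorm_toReal two_ne_zero ENNReal.ofNat_ne_top]
  simp only [enorm_eq_self, ENNReal.toReal_ofNat]
  have h1 : ∫⁻ x, f x ^ (2 : ℝ) ∂ν ≤ M ^ (2 - p.toReal) * ∫⁻ x, f x ^ p.toReal ∂ν := by
    rw [← lintegral_const_mul _ (hf.pow_const _)]
    refine lintegral_mono fun x => ?_
    calc f x ^ (2 : ℝ) = f x ^ (2 - p.toReal) * f x ^ p.toReal := by
          rw [← ENNReal.rpow_add_of_nonneg _ _ (by linarith) (by linarith), sub_add_cancel]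
      _ ≤ _ := mul_le_mul_left (ENNReal.rpow_le_rpow (hM x) (by linarith)) _
  calc _ ≤ _ := ENNReal.rpow_le_rpow h1 (by positivity)
    _ = _ := by
      rw [ENNReal.mul_rpow_of_nonneg _ _ (by positivity), ← ENNReal.rpow_mul, ← ENNReal.rpow_mul]
      congr 2 <;> field_simp

section Convolution

variable {Z : Type*} [AddCommGroup Z] [MeasurableSpace Z] [MeasurableAdd₂ Z] [MeasurableNeg Z]
  {ν : Measure Z} [SFinite ν] [ν.IsAddLeftInvariant] [ν.IsNegInvariant]

/-- Hölder with respect to the weight `k (x - y)`, then Tonelli and invariance of the measure. -/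
theorem lintegral_conv_rpow_le {k f : Z → ℝ≥0∞} (hk : Measurable k) (hf : Measurable f) {q : ℝ}
    (hq : 1 ≤ q) :
    ∫⁻ x, (∫⁻ y, k (x - y) * f y ∂ν) ^ q ∂ν ≤ (∫⁻ y, k y ∂ν) ^ q * ∫⁻ y, f y ^ q ∂ν := by
  have hq0 : 0 < q := by linarith
  have hkm : Measurable fun r : Z × Z => k (r.1 - r.2) := hk.comp (measurable_fst.sub measurable_snd)
  have h1 : ∀ x, ∫⁻ y, k (x - y) ∂ν = ∫⁻ y, k y ∂ν := fun x => lintegral_sub_left_eq_self k x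
  have h2 : ∀ x, (∫⁻ y, k (x - y) * f y ∂ν) ^ q
      ≤ (∫⁻ y, k y ∂ν) ^ (q - 1) * ∫⁻ y, k (x - y) * f y ^ q ∂ν := by
    intro x
    have hkx : Measurable fun y => k (x - y) := hkm.comp (measurable_const.prodMk measurable_id)
    -- The kernel is split as `k ^ (1 - 1/q) · k ^ (1/q)`; this form of Hölder includes `q = 1`.
    have h := ENNReal.lintegral_mul_norm_pow_le (μ := ν) (p := 1 - 1 / q) (q := 1 / q)
      hkx.aemeasurable (hkx.mul (hf.pow_const q)).aemeasurable
      (by rw [sub_nonneg, div_le_one hq0]; exact hq) (by positivity) (by ring)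
    have h3 : ∀ y, k (x - y) ^ (1 - 1 / q) * (k (x - y) * f y ^ q) ^ (1 / q) = k (x - y) * f y := by
      intro y
      rw [ENNReal.mul_rpow_of_nonneg _ _ (by positivity), ← ENNReal.rpow_mul, mul_one_div_cancel
        hq0.ne', ENNReal.rpow_one, ← mul_assoc, ← ENNReal.rpow_add_of_nonneg _ _
        (by rw [sub_nonneg, div_le_one hq0]; exact hq) (by positivity), sub_add_cancel,
        ENNReal.rpow_one]
    simp only [Pi.mul_apply, h3, h1] at h
    calc _ ≤ _ := ENNReal.rpow_le_rpow h hq0.le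
      _ = _ := by
        rw [ENNReal.mul_rpow_of_nonneg _ _ hq0.le, ← ENNReal.rpow_mul, ← ENNReal.rpow_mul,
          one_div_mul_cancel hq0.ne', ENNReal.rpow_one]
        congr 2
        field_simp
  calc ∫⁻ x, (∫⁻ y, k (x - y) * f y ∂ν) ^ q ∂ν
      ≤ ∫⁻ x, (∫⁻ y, k y ∂ν) ^ (q - 1) * ∫⁻ y, k (x - y) * f y ^ q ∂ν ∂ν := lintegral_mono h2
    _ = (∫⁻ y, k y ∂ν) ^ (q - 1) * ∫⁻ x, ∫⁻ y, k (x - y) * f y ^ q ∂ν ∂ν :=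
        lintegral_const_mul _ (Measurable.lintegral_prod_right'
          (f := fun r : Z × Z => k (r.1 - r.2) * f r.2 ^ q)
          (hkm.mul ((hf.comp measurable_snd).pow_const q)))
    _ = (∫⁻ y, k y ∂ν) ^ (q - 1) * ∫⁻ y, ∫⁻ x, k (x - y) * f y ^ q ∂ν ∂ν := by
        rw [lintegral_lintegral_swap]
        exact (hkm.mul ((hf.comp measurable_snd).pow_const q)).aemeasurable
    _ = (∫⁻ y, k y ∂ν) ^ (q - 1) * ((∫⁻ y, k y ∂ν) * ∫⁻ y, f y ^ q ∂ν) := by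
        congr 1
        rw [← lintegral_const_mul _ (hf.pow_const q)]
        refine lintegral_congr fun y => ?_
        have hky : Measurable fun x => k (x - y) := hkm.comp (measurable_id.prodMk measurable_const)
        rw [lintegral_mul_const _ hky]
        congr 1
        exact lintegral_sub_right_eq_self k y
    _ = _ := by
        nth_rw 2 [← ENNReal.rpow_one (∫⁻ y, k y ∂ν)]
        rw [← mul_assoc, ← ENNReal.rpow_add_of_nonneg _ _ (by linarith) zero_le_one, sub_add_cancel]

theorem eLpNorm_conv_le {k f : Z → ℝ≥0∞} (hk : Measurable k) (hf : Measurable f) {p : ℝ≥0∞}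
    (hp : 1 ≤ p) (hp' : p ≠ ∞) :
    eLpNorm (fun x => ∫⁻ y, k (x - y) * f y ∂ν) p ν ≤ (∫⁻ y, k y ∂ν) * eLpNorm f p ν := by
  have hq : 1 ≤ p.toReal := by
    have := ENNReal.toReal_mono hp' hp; simpa using this
  have hp0 : p ≠ 0 := (zero_lt_one.trans_le hp).ne'
  rw [eLpNorm_eq_lintegral_rpow_enorm_toReal hp0 hp', eLpNorm_eq_lintegral_rpow_enorm_toReal hp0 hp']
  simp only [enorm_eq_self]
  calc _ ≤ _ := ENNReal.rpow_le_rpow (lintegral_conv_rpow_le hk hf hq) (by positivity)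
    _ = _ := by
      rw [ENNReal.mul_rpow_of_nonneg _ _ (by positivity), ← ENNReal.rpow_mul,
        mul_one_div_cancel (by positivity), ENNReal.rpow_one]

/-- A non-sharp substitute for Young's inequality from `L^p` to `L²`: the sup bound with `k ∈
L^{p'}` is interpolated with the `L^p` bound with `k ∈ L¹`. It suffices because `k` will be Schwartz
or a transform with rapid decay. -/
theorem eLpNorm_two_conv_le {k f : Z → ℂ} (hk : Measurable k) (hf : Measurable f) {p p' : ℝ≥0∞}
    [ENNReal.HolderConjugate p p'] (hp : p ≤ 2) :
    eLpNorm (fun x => ∫⁻ y, ‖k (x - y)‖ₑ * ‖f y‖ₑ ∂ν) 2 ν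
      ≤ eLpNorm k p' ν ^ (1 - p.toReal / 2) * eLpNorm k 1 ν ^ (p.toReal / 2) * eLpNorm f p ν := by
  have hp1 : 1 ≤ p := ENNReal.HolderConjugate.one_le p p'
  have hpt : p ≠ ∞ := ne_top_of_le_ne_top ENNReal.ofNat_ne_top hp
  have hq2 : p.toReal ≤ 2 := by
    have := ENNReal.toReal_mono ENNReal.ofNat_ne_top hp; simpa using this
  have hM : ∀ x, ∫⁻ y, ‖k (x - y)‖ₑ * ‖f y‖ₑ ∂ν ≤ eLpNorm k p' ν * eLpNorm f p ν := by
    intro x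
    have hmp : MeasurePreserving (fun y => x - y) ν ν := Measure.measurePreserving_sub_left ν x
    have h := eLpNorm_smul_le_mul_eLpNorm (μ := ν) (p := p') (q := p) (r := 1)
      hf.aestronglyMeasurable (hk.comp hmp.measurable).aestronglyMeasurable
    rw [eLpNorm_comp_measurePreserving hk.aestronglyMeasurable hmp,
      eLpNorm_one_eq_lintegral_enorm] at h
    simpa only [Pi.smul_apply', Function.comp, smul_eq_mul, enorm_mul] using h
  have hm : Measurable fun x => ∫⁻ y, ‖k (x - y)‖ₑ * ‖f y‖ₑ ∂ν :=
    Measurable.lintegral_prod_right' (f := fun r : Z × Z => ‖k (r.1 - r.2)‖ₑ * ‖f r.2‖ₑ)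
      ((hk.comp (measurable_fst.sub measurable_snd)).enorm.mul (hf.comp measurable_snd).enorm)
  refine (eLpNorm_two_le_of_le hm hM hp1 hp).trans ?_
  have h2 := eLpNorm_conv_le (ν := ν) hk.enorm hf.enorm hp1 hpt
  rw [eLpNorm_enorm, ← eLpNorm_one_eq_lintegral_enorm] at h2
  calc _ ≤ (eLpNorm k p' ν * eLpNorm f p ν) ^ (1 - p.toReal / 2)
        * (eLpNorm k 1 ν * eLpNorm f p ν) ^ (p.toReal / 2) := by gcongr
    _ = _ := by
      rw [ENNReal.mul_rpow_of_nonneg _ _ (by linarith), ENNReal.mul_rpow_of_nonneg _ _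
        (by positivity)]
      have h3 : eLpNorm f p ν = eLpNorm f p ν ^ (1 - p.toReal / 2)
          * eLpNorm f p ν ^ (p.toReal / 2) := by
        rw [← ENNReal.rpow_add_of_nonneg _ _ (by linarith) (by positivity), sub_add_cancel,
          ENNReal.rpow_one]
      conv_rhs => rw [h3]
      ring

end Convolution

/-! ### Plancherel's theorem and the short-time Fourier transform on `L²` -/

section Plancherel

open scoped FourierTransform

variable {d : ℕ}

theorem eLpNorm_two_sq {α F : Type*} [MeasurableSpace α] [NormedAddCommGroup F] (f : α → F)
    (μ : Measure α) : eLpNorm f 2 μ ^ 2 = ∫⁻ x, ‖f x‖ₑ ^ 2 ∂μ := by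
  rw [eLpNorm_eq_lintegral_rpow_enorm_toReal two_ne_zero ENNReal.ofNat_ne_top,
    ← ENNReal.rpow_natCast, ← ENNReal.rpow_mul]
  simp

theorem continuous_fourier_of_integrable {u : TFSpace d → ℂ} (hu : Integrable u) :
    Continuous (𝓕 u) :=
  VectorFourier.fourierIntegral_continuous Real.continuous_fourierChar
    (by exact continuous_inner) hu

/-- The `L²` Fourier transform of an integrable function is given by the Fourier integral. -/
theorem fourier_toLp_two_ae_eq {u : TFSpace d → ℂ} (hu : Integrable u) (hu2 : MemLp u 2) :
    (𝓕 (hu2.toLp u) : Lp ℂ 2 (volume : Measure (TFSpace d))) =ᵐ[volume] 𝓕 u := by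
  refine ae_eq_of_integral_contDiff_smul_eq ((Lp.memLp _).locallyIntegrable one_le_two)
    (continuous_fourier_of_integrable hu).locallyIntegrable fun g hg hgc => ?_
  have hg₁ : HasCompactSupport (Complex.ofRealCLM ∘ g) := hgc.comp_left rfl
  have hg₂ : ContDiff ℝ ((⊤ : ℕ∞) : WithTop ℕ∞) (Complex.ofRealCLM ∘ g) := by fun_prop
  set η := hg₁.toSchwartzMap hg₂ with hη
  have hη' : ∀ x, η x = (g x : ℂ) := fun x => rfl
  have h1 := DFunLike.congr_fun (Lp.fourier_toTemperedDistribution_eq (hu2.toLp u)) η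
  -- Both sides are tested against `η`: the `L²` transform agrees with the distributional one, and
  -- for integrable `u` the transform moves between the factors of the pairing.
  rw [TemperedDistribution.fourier_apply, Lp.toTemperedDistribution_apply,
    Lp.toTemperedDistribution_apply] at h1
  have h2 : ∫ x, 𝓕 η x • (hu2.toLp u) x = ∫ x, 𝓕 η x • u x := by
    refine integral_congr_ae ?_
    filter_upwards [hu2.coeFn_toLp] with x hx
    rw [hx]
  have h3 : ∫ x, 𝓕 η x • u x = ∫ x, η x • 𝓕 u x :=
    VectorFourier.integral_fourierIntegral_smul_eq_flip (L := innerₗ (TFSpace d))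
      Real.continuous_fourierChar (by exact continuous_inner) η.integrable hu |>.trans (by
        rw [flip_innerₗ]; rfl)
  rw [h2, h3] at h1
  simpa only [hη', Complex.real_smul, smul_eq_mul] using h1.symm

theorem eLpNorm_fourier_two {u : TFSpace d → ℂ} (hu : Integrable u) (hu2 : MemLp u 2) :
    eLpNorm (𝓕 u) 2 = eLpNorm u 2 := by
  rw [← eLpNorm_congr_ae (fourier_toLp_two_ae_eq hu hu2), ← eLpNorm_congr_ae hu2.coeFn_toLp]
  have := Lp.norm_fourier_eq (hu2.toLp u)
  rwa [Lp.norm_def, Lp.norm_def, ENNReal.toReal_eq_toReal_iff' (Lp.eLpNorm_ne_top _)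
    (Lp.eLpNorm_ne_top _)] at this

theorem measurable_mul_conj_comp_sub {φ f : TFSpace d → ℂ} (hφ : Measurable φ) (hf : Measurable f) :
    Measurable fun r : TFSpace d × TFSpace d => f r.2 * starRingEnd ℂ (φ (r.2 - r.1)) :=
  (hf.comp measurable_snd).mul
    (Complex.continuous_conj.measurable.comp (hφ.comp (measurable_snd.sub measurable_fst)))

theorem stronglyMeasurable_stft {φ f : TFSpace d → ℂ} (hφ : Measurable φ) (hf : Measurable f) :
    StronglyMeasurable (stft φ f) := by
  have h1 : Measurable fun r : TFPlane d × TFSpace d => (r.1.1, r.2) :=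
    (measurable_fst.comp measurable_fst).prodMk measurable_snd
  have h3 : Measurable fun r : TFPlane d × TFSpace d =>
      f r.2 * starRingEnd ℂ (φ (r.2 - r.1.1)) :=
    Measurable.comp (g := fun r : TFSpace d × TFSpace d => f r.2 * starRingEnd ℂ (φ (r.2 - r.1)))
      (measurable_mul_conj_comp_sub hφ hf) h1
  have h4 : Continuous fun r : TFPlane d × TFSpace d => tfCharConj r.1.2 r.2 := by
    unfold tfCharConj; fun_prop
  have h5 := (h3.mul h4.measurable).stronglyMeasurable
  exact h5.integral_prod_right' (ν := volume)

theorem memLp_conj_comp_sub {φ : TFSpace d → ℂ} {p : ℝ≥0∞} (hφ : MemLp φ p) (x : TFSpace d) :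
    MemLp (fun t => starRingEnd ℂ (φ (t - x))) p := by
  have h : MemLp (fun t => φ (t - x)) p :=
    hφ.comp_measurePreserving (measurePreserving_sub_right volume x)
  exact h.congr_norm (Complex.continuous_conj.comp_aestronglyMeasurable h.1)
    (Filter.Eventually.of_forall fun t => (RCLike.norm_conj _).symm)

theorem integrable_mul_conj_comp_sub {φ f : TFSpace d → ℂ} (hφ : MemLp φ 2) (hf : MemLp f 2)
    (x : TFSpace d) : Integrable fun t => f t * starRingEnd ℂ (φ (t - x)) :=
  hf.integrable_mul (memLp_conj_comp_sub hφ x)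

theorem lintegral_enorm_sq_mul_conj_comp_sub {φ f : TFSpace d → ℂ} (hφ : Measurable φ)
    (hf : Measurable f) :
    ∫⁻ x, ∫⁻ t, ‖f t * starRingEnd ℂ (φ (t - x))‖ₑ ^ 2 = eLpNorm φ 2 ^ 2 * eLpNorm f 2 ^ 2 := by
  rw [lintegral_lintegral_swap
    ((measurable_mul_conj_comp_sub hφ hf).enorm.pow_const 2).aemeasurable]
  rw [eLpNorm_two_sq, eLpNorm_two_sq, ← lintegral_const_mul _ (hf.enorm.pow_const 2)]
  refine lintegral_congr fun t => ?_
  have hm : Measurable fun x => ‖φ (t - x)‖ₑ ^ 2 :=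
    (hφ.comp (measurable_const.sub measurable_id)).enorm.pow_const 2
  simp only [enorm_mul, mul_pow, RCLike.enorm_conj]
  rw [lintegral_const_mul _ hm, mul_comm,
    lintegral_sub_left_eq_self (fun x => ‖φ x‖ₑ ^ 2) t]

/-- Plancherel in `ω` for almost every `x`, then Tonelli in `x`. -/
theorem eLpNorm_stft_two {φ f : TFSpace d → ℂ} (hφm : Measurable φ) (hfm : Measurable f)
    (hφ : MemLp φ 2) (hf : MemLp f 2) :
    eLpNorm (stft φ f) 2 = eLpNorm φ 2 * eLpNorm f 2 := by
  have key : eLpNorm (stft φ f) 2 ^ 2 = (eLpNorm φ 2 * eLpNorm f 2) ^ 2 := by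
    rw [eLpNorm_two_sq, Measure.volume_eq_prod,
      lintegral_prod _ ((stronglyMeasurable_stft hφm hfm).measurable.enorm.pow_const 2).aemeasurable,
      mul_pow, ← lintegral_enorm_sq_mul_conj_comp_sub hφm hfm]
    refine lintegral_congr_ae ?_
    have hfin : ∫⁻ x, ∫⁻ t, ‖f t * starRingEnd ℂ (φ (t - x))‖ₑ ^ 2 ≠ ∞ := by
      rw [lintegral_enorm_sq_mul_conj_comp_sub hφm hfm]
      exact ENNReal.mul_ne_top (ENNReal.pow_ne_top hφ.2.ne) (ENNReal.pow_ne_top hf.2.ne)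
    filter_upwards [ae_lt_top (Measurable.lintegral_prod_right'
      ((measurable_mul_conj_comp_sub hφm hfm).enorm.pow_const 2)) hfin] with x hx
    -- The product is in `L¹` for every `x`, but in `L²` only for almost every `x`; Plancherel for
    -- the Fourier integral uses both.
    have hu := integrable_mul_conj_comp_sub hφ hf x
    have hu2 : MemLp (fun t => f t * starRingEnd ℂ (φ (t - x))) 2 := by
      refine ⟨hu.1, ?_⟩
      have := eLpNorm_two_sq (fun t => f t * starRingEnd ℂ (φ (t - x))) volume
      refine lt_top_iff_ne_top.2 fun h => ?_
      rw [h] at this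
      rw [← this] at hx
      simp at hx
    simp only [stft_eq_fourier]
    rw [← eLpNorm_two_sq, ← eLpNorm_two_sq]
    exact congrArg (· ^ 2) (eLpNorm_fourier_two hu hu2)
  exact ENNReal.pow_right_strictMono two_ne_zero |>.injective key

end Plancherel

/-! ### Moyal's identity, change of window, the adjoint, and convolution with `μ` -/

section MoyalIdentity

open scoped FourierTransform

variable {d : ℕ}

theorem stft_congr_ae {φ φ' f f' : TFSpace d → ℂ} (hφ : φ =ᵐ[volume] φ') (hf : f =ᵐ[volume] f') :
    stft φ f = stft φ' f' := by
  funext z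
  refine integral_congr_ae ?_
  filter_upwards [hf, (measurePreserving_sub_right (volume : Measure (TFSpace d))
    z.1).quasiMeasurePreserving.ae_eq_comp hφ] with t h1 h2
  simp only [Function.comp] at h2
  rw [h1, h2]

theorem measurable_coe_Lp {α : Type*} [MeasurableSpace α] {μ : Measure α} {p : ℝ≥0∞}
    (f : Lp ℂ p μ) : Measurable f :=
  (Lp.stronglyMeasurable f).measurable

theorem integrable_stft_integrand {φ f : TFSpace d → ℂ} (hφ : MemLp φ 2) (hf : MemLp f 2)
    (z : TFPlane d) :
    Integrable fun t => f t * starRingEnd ℂ (φ (t - z.1)) * tfCharConj z.2 t := by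
  refine (integrable_mul_conj_comp_sub hφ hf z.1).mul_bdd (c := 1) ?_
    (Filter.Eventually.of_forall fun t => (norm_tfCharConj z.2 t).le)
  have : Continuous fun t => tfCharConj z.2 t := by unfold tfCharConj; fun_prop
  exact this.aestronglyMeasurable

theorem memLp_stft (φ f : Lp ℂ 2 (volume : Measure (TFSpace d))) :
    MemLp (stft φ f) 2 volume := by
  refine ⟨(stronglyMeasurable_stft (measurable_coe_Lp φ)
    (measurable_coe_Lp f)).aestronglyMeasurable, ?_⟩
  rw [eLpNorm_stft_two (measurable_coe_Lp φ) (measurable_coe_Lp f) (Lp.memLp φ) (Lp.memLp f)]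
  exact ENNReal.mul_lt_top (Lp.memLp φ).2 (Lp.memLp f).2

/-- The short-time Fourier transform with an `L²` window as a bounded operator on `L²`. -/
noncomputable def stftCLM (φ : Lp ℂ 2 (volume : Measure (TFSpace d))) :
    Lp ℂ 2 (volume : Measure (TFSpace d)) →L[ℂ] Lp ℂ 2 (volume : Measure (TFPlane d)) :=
  LinearMap.mkContinuous
    { toFun := fun f => (memLp_stft φ f).toLp (stft φ f)
      map_add' := fun f f' => by
        have h : stft φ (f + f' : Lp ℂ 2 (volume : Measure (TFSpace d)))
            = stft φ f + stft φ f' := by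
          rw [stft_congr_ae (Filter.EventuallyEq.refl _ _) (Lp.coeFn_add f f')]
          funext z
          simp only [stft, Pi.add_apply, add_mul]
          exact integral_add (integrable_stft_integrand (Lp.memLp φ) (Lp.memLp f) z)
            (integrable_stft_integrand (Lp.memLp φ) (Lp.memLp f') z)
        rw [← MemLp.toLp_add]
        exact MemLp.toLp_congr _ _ (Filter.EventuallyEq.of_eq h)
      map_smul' := fun c f => by
        have h : stft φ (c • f : Lp ℂ 2 (volume : Measure (TFSpace d))) = c • stft φ f := by
          rw [stft_congr_ae (Filter.EventuallyEq.refl _ _) (Lp.coeFn_smul c f)]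
          funext z
          simp only [stft, Pi.smul_apply, smul_eq_mul, mul_assoc]
          exact integral_const_mul _ _
        rw [RingHom.id_apply, ← MemLp.toLp_const_smul]
        exact MemLp.toLp_congr _ _ (Filter.EventuallyEq.of_eq h) }
    ‖φ‖ (fun f => by
      change ‖(memLp_stft φ f).toLp (stft φ f)‖ ≤ _
      rw [Lp.norm_toLp, eLpNorm_stft_two (measurable_coe_Lp φ) (measurable_coe_Lp f) (Lp.memLp φ)
        (Lp.memLp f), ENNReal.toReal_mul]
      rfl)

theorem coeFn_stftCLM (φ f : Lp ℂ 2 (volume : Measure (TFSpace d))) :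
    stftCLM φ f =ᵐ[volume] stft φ f :=
  (memLp_stft φ f).coeFn_toLp

theorem norm_stftCLM (φ f : Lp ℂ 2 (volume : Measure (TFSpace d))) :
    ‖stftCLM φ f‖ = ‖φ‖ * ‖f‖ := by
  change ‖(memLp_stft φ f).toLp (stft φ f)‖ = _
  rw [Lp.norm_toLp, eLpNorm_stft_two (measurable_coe_Lp φ) (measurable_coe_Lp f) (Lp.memLp φ)
    (Lp.memLp f), ENNReal.toReal_mul]
  rfl

/-- Moyal's identity for a fixed window. -/
theorem inner_stftCLM (φ f f' : Lp ℂ 2 (volume : Measure (TFSpace d))) :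
    inner ℂ (stftCLM φ f) (stftCLM φ f') = ‖φ‖ ^ 2 * inner ℂ f f' := by
  -- Polarization reduces the identity to the norm equality.
  rw [inner_eq_sum_norm_sq_div_four (𝕜 := ℂ), inner_eq_sum_norm_sq_div_four (𝕜 := ℂ) f f']
  simp only [← map_smul, ← map_add, ← map_sub, norm_stftCLM]
  simp only [RCLike.ofReal_eq_complex_ofReal, Complex.ofReal_mul]
  ring

theorem memLp_tfShift {f : TFSpace d → ℂ} {p : ℝ≥0∞} (hf : MemLp f p) (w : TFPlane d) :
    MemLp (tfShift w f) p := by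
  have h : MemLp (fun t => f (t - w.1)) p :=
    hf.comp_measurePreserving (measurePreserving_sub_right volume w.1)
  have hc : Continuous fun t => starRingEnd ℂ (tfCharConj w.2 t) := by
    have : Continuous fun t => tfCharConj w.2 t := by unfold tfCharConj; fun_prop
    exact Complex.continuous_conj.comp this
  exact h.congr_norm (hc.aestronglyMeasurable.mul h.1) (Filter.Eventually.of_forall fun t => by
    simp only [tfShift, norm_mul, RCLike.norm_conj, norm_tfCharConj, one_mul])

/-- The time-frequency shift of an `L²` function. -/
noncomputable def tfShiftLp (w : TFPlane d) (f : Lp ℂ 2 (volume : Measure (TFSpace d))) :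
    Lp ℂ 2 (volume : Measure (TFSpace d)) :=
  (memLp_tfShift (Lp.memLp f) w).toLp _

theorem coeFn_tfShiftLp (w : TFPlane d) (f : Lp ℂ 2 (volume : Measure (TFSpace d))) :
    tfShiftLp w f =ᵐ[volume] tfShift w f :=
  (memLp_tfShift (Lp.memLp f) w).coeFn_toLp

theorem stft_eq_inner_tfShiftLp (φ f : Lp ℂ 2 (volume : Measure (TFSpace d))) (w : TFPlane d) :
    stft φ f w = inner ℂ (tfShiftLp w φ) f := by
  rw [L2.inner_def, stft]
  refine integral_congr_ae ?_
  filter_upwards [coeFn_tfShiftLp w φ] with t ht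
  rw [ht, RCLike.inner_apply, tfShift, map_mul, starRingEnd_self_apply]
  ring

theorem enorm_stft_tfShiftLp (φ f : Lp ℂ 2 (volume : Measure (TFSpace d))) (w z : TFPlane d) :
    ‖stft φ (tfShiftLp w f) z‖ₑ = ‖stft f φ (w - z)‖ₑ := by
  rw [stft_congr_ae (Filter.EventuallyEq.refl _ _) (coeFn_tfShiftLp w f), ← ofReal_norm,
    norm_stft_tfShift, norm_stft_sub_comm, ofReal_norm]

/-- Pointwise change of the window of a short-time Fourier transform. -/
theorem enorm_stft_le_lintegral (γ φ f : Lp ℂ 2 (volume : Measure (TFSpace d))) (w : TFPlane d) :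
    ENNReal.ofReal (‖γ‖ ^ 2) * ‖stft φ f w‖ₑ
      ≤ ∫⁻ z, ‖stft φ γ (w - z)‖ₑ * ‖stft γ f z‖ₑ := by
  -- Moyal for `π(w)φ` and `f`, since `V_φ f (w) = ⟨f, π(w)φ⟩`.
  have h := inner_stftCLM γ (tfShiftLp w φ) f
  rw [← stft_eq_inner_tfShiftLp, L2.inner_def] at h
  have h1 := congrArg (fun c : ℂ => ‖c‖ₑ) h
  simp only [enorm_mul] at h1
  rw [← ofReal_norm (((‖γ‖ : ℂ)) ^ 2), norm_pow, Complex.norm_real, norm_norm] at h1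
  rw [← h1]
  refine (enorm_integral_le_lintegral_enorm _).trans (le_of_eq ?_)
  refine lintegral_congr_ae ?_
  filter_upwards [coeFn_stftCLM γ (tfShiftLp w φ), coeFn_stftCLM γ f] with z h2 h3
  rw [RCLike.inner_apply, enorm_mul, RCLike.enorm_conj, h2, h3, enorm_stft_tfShiftLp, mul_comm]

theorem eLpNorm_one_stft_comm (φ f : TFSpace d → ℂ) :
    ∫⁻ z, ‖stft φ f z‖ₑ = eLpNorm (stft f φ) 1 volume := by
  rw [eLpNorm_one_eq_lintegral_enorm, ← lintegral_neg_eq_self]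
  refine lintegral_congr fun z => ?_
  rw [← ofReal_norm, norm_stft_neg, ofReal_norm]

theorem eLpNorm_stft_le (γ φ f : Lp ℂ 2 (volume : Measure (TFSpace d))) {p : ℝ≥0∞} (hp : 1 ≤ p)
    (hp' : p ≠ ∞) :
    ENNReal.ofReal (‖γ‖ ^ 2) * eLpNorm (stft φ f) p volume
      ≤ eLpNorm (stft γ φ) 1 volume * eLpNorm (stft γ f) p volume := by
  have h1 := eLpNorm_conv_le (ν := (volume : Measure (TFPlane d)))
    (stronglyMeasurable_stft (measurable_coe_Lp φ) (measurable_coe_Lp γ)).measurable.enorm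
    (stronglyMeasurable_stft (measurable_coe_Lp γ) (measurable_coe_Lp f)).measurable.enorm hp hp'
  rw [eLpNorm_one_stft_comm, eLpNorm_enorm] at h1
  refine le_trans ?_ h1
  have h2 : eLpNorm (((‖γ‖ ^ 2 : ℝ) : ℂ) • stft φ f) p volume
      = ENNReal.ofReal (‖γ‖ ^ 2) * eLpNorm (stft φ f) p volume := by
    rw [eLpNorm_const_smul, ← ofReal_norm, Complex.norm_real,
      Real.norm_of_nonneg (by positivity)]
  rw [← h2]
  refine eLpNorm_mono_enorm fun w => ?_
  rw [enorm_eq_self, Pi.smul_apply, enorm_smul, ← ofReal_norm, Complex.norm_real,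
    Real.norm_of_nonneg (by positivity)]
  exact enorm_stft_le_lintegral γ φ f w

/-! ### The adjoint of the short-time Fourier transform -/

theorem exists_isAdjointSTFT (φ : Lp ℂ 2 (volume : Measure (TFSpace d))) {F : TFPlane d → ℂ}
    (hF : MemLp F 2 volume) :
    ∃ f, IsAdjointSTFT φ F f := by
  refine ⟨ContinuousLinearMap.adjoint (stftCLM φ) (hF.toLp F), fun h => ⟨?_, ?_⟩⟩
  · have h1 := memLp_stft φ h
    exact hF.integrable_mul (h1.congr_norm (Complex.continuous_conj.comp_aestronglyMeasurable h1.1)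
      (Filter.Eventually.of_forall fun t => (RCLike.norm_conj _).symm))
  · rw [ContinuousLinearMap.adjoint_inner_right, L2.inner_def]
    refine integral_congr_ae ?_
    filter_upwards [coeFn_stftCLM φ h, hF.coeFn_toLp] with z h1 h2
    rw [RCLike.inner_apply, h1, h2]

/-- Testing the weak integral on `h = π(w)γ` gives `V_γ f (w)`, and covariance bounds it by the
convolution of `|V_γ φ|` with `|F|`. -/
theorem IsAdjointSTFT.eLpNorm_stft_le {φ : Lp ℂ 2 (volume : Measure (TFSpace d))}
    {F : TFPlane d → ℂ} {f : Lp ℂ 2 (volume : Measure (TFSpace d))} (hf : IsAdjointSTFT φ F f)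
    (hF : AEStronglyMeasurable F volume) (γ : Lp ℂ 2 (volume : Measure (TFSpace d))) {p : ℝ≥0∞}
    (hp : 1 ≤ p) (hp' : p ≠ ∞) :
    eLpNorm (stft γ f) p volume ≤ eLpNorm (stft γ φ) 1 volume * eLpNorm F p volume := by
  have h1 := eLpNorm_conv_le (ν := (volume : Measure (TFPlane d)))
    (stronglyMeasurable_stft (measurable_coe_Lp γ) (measurable_coe_Lp φ)).measurable.enorm
    hF.stronglyMeasurable_mk.measurable.enorm hp hp'
  rw [← eLpNorm_one_eq_lintegral_enorm, eLpNorm_enorm, ← eLpNorm_congr_ae hF.ae_eq_mk] at h1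
  refine le_trans (eLpNorm_mono_enorm fun w => ?_) h1
  rw [enorm_eq_self, stft_eq_inner_tfShiftLp, (hf _).2]
  refine (enorm_integral_le_lintegral_enorm _).trans (le_of_eq ?_)
  refine lintegral_congr_ae ?_
  filter_upwards [hF.ae_eq_mk] with z hz
  rw [enorm_mul, RCLike.enorm_conj, enorm_stft_tfShiftLp, mul_comm, hz]

theorem aestronglyMeasurable_convolution_mul {μ V : TFPlane d → ℂ}
    (hμ : AEStronglyMeasurable μ volume) (hV : Measurable V) :
    AEStronglyMeasurable (convolution μ V (ContinuousLinearMap.mul ℂ ℂ) volume) volume :=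
  (hμ.convolution_integrand (ContinuousLinearMap.mul ℂ ℂ)
    hV.aestronglyMeasurable).integral_prod_right'

theorem eLpNorm_convolution_mul_le {μ V : TFPlane d → ℂ} (hμ : AEStronglyMeasurable μ volume)
    (hV : Measurable V) {p : ℝ≥0∞} (hp : 1 ≤ p) (hp' : p ≠ ∞) :
    eLpNorm (convolution μ V (ContinuousLinearMap.mul ℂ ℂ) volume) p volume
      ≤ eLpNorm μ 1 volume * eLpNorm V p volume := by
  have h1 := eLpNorm_conv_le (ν := (volume : Measure (TFPlane d)))
    hμ.stronglyMeasurable_mk.measurable.enorm hV.enorm hp hp'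
  rw [← eLpNorm_one_eq_lintegral_enorm, eLpNorm_enorm, ← eLpNorm_congr_ae hμ.ae_eq_mk] at h1
  refine le_trans (eLpNorm_mono_enorm fun x => ?_) h1
  rw [enorm_eq_self, convolution_def]
  refine (enorm_integral_le_lintegral_enorm _).trans (le_of_eq ?_)
  rw [← lintegral_sub_left_eq_self (fun y => ‖hμ.mk μ (x - y)‖ₑ * ‖V y‖ₑ) x]
  refine lintegral_congr_ae ?_
  filter_upwards [hμ.ae_eq_mk] with t ht
  rw [ContinuousLinearMap.mul_apply', enorm_mul, sub_sub_cancel, ht]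

end MoyalIdentity

section Modulation

open scoped FourierTransform

variable {d : ℕ}

/-! ### Modulation spaces with exponent at most two consist of `L²` functions -/

theorem SchwartzMap.integral_norm_sq_eq_norm_toLp_sq (g : 𝓢(TFSpace d, ℂ)) :
    ∫ s, ‖g s‖ ^ 2 = ‖g.toLp 2 volume‖ ^ 2 := by
  have h := SchwartzMap.inner_toL2_toL2_eq g g (volume : Measure (TFSpace d))
  simp only [inner_self_eq_norm_sq_to_K, RCLike.ofReal_eq_complex_ofReal, ← Complex.ofReal_pow]
    at h
  rw [integral_complex_ofReal] at h
  exact (Complex.ofReal_injective h).symm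

theorem SchwartzMap.norm_toLp_two_pos {g : 𝓢(TFSpace d, ℂ)} (hg : g ≠ 0) :
    0 < ‖g.toLp 2 volume‖ := by
  rw [norm_pos_iff]
  intro h
  exact hg (SchwartzMap.injective_toLp 2 volume
    (h.trans (map_zero (SchwartzMap.toLpCLM ℂ ℂ 2 volume)).symm))

/-- The reproducing inequality bounds `V_g ψ` by a convolution with the rapidly decaying `V_g g`,
which maps `L^p` to `L²` when `p ≤ 2`. -/
theorem eLpNorm_stftDistribution_two_lt_top {p : ℝ≥0∞} (hp : 1 ≤ p) (hp' : p ≤ 2)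
    {g : 𝓢(TFSpace d, ℂ)} (hg : g ≠ 0) {ψ : 𝓢'(TFSpace d, ℂ)} (hψ : ψ ∈ modulationSpace g p) :
    eLpNorm (stftDistribution g ψ) 2 volume < ∞ := by
  set c := ENNReal.ofReal (∫ s, ‖g s‖ ^ 2) with hc
  have hc0 : c ≠ 0 := by
    rw [hc, SchwartzMap.integral_norm_sq_eq_norm_toLp_sq]
    simpa using (SchwartzMap.norm_toLp_two_pos hg).ne'
  have hpq : ENNReal.HolderConjugate p (1 - p⁻¹)⁻¹ := ENNReal.HolderConjugate.inv_one_sub_inv' hp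
  have h1 := eLpNorm_two_conv_le (ν := (volume : Measure (TFPlane d))) (p' := (1 - p⁻¹)⁻¹)
    (continuous_stft_schwartz g g).measurable (continuous_stftDistribution g ψ).measurable hp'
  have hp2 : p.toReal ≤ 2 := by
    have := ENNReal.toReal_mono ENNReal.ofNat_ne_top hp'; simpa using this
  have h2 : eLpNorm (fun x => ∫⁻ y, ‖stft g g (x - y)‖ₑ * ‖stftDistribution g ψ y‖ₑ) 2 volume
      < ∞ := by
    refine h1.trans_lt (ENNReal.mul_lt_top (ENNReal.mul_lt_top ?_ ?_) hψ)
    · exact ENNReal.rpow_lt_top_of_nonneg (by linarith)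
        (memLp_stft_schwartz g g _ (by simp)).2.ne
    · exact ENNReal.rpow_lt_top_of_nonneg (by positivity) (memLp_stft_schwartz g g 1 le_rfl).2.ne
  have h3 : eLpNorm (((∫ s, ‖g s‖ ^ 2 : ℝ) : ℂ) • stftDistribution g ψ) 2 volume < ∞ := by
    refine (eLpNorm_mono_enorm fun w => ?_).trans_lt h2
    rw [enorm_eq_self, Pi.smul_apply, enorm_smul, ← ofReal_norm, Complex.norm_real,
      Real.norm_of_nonneg (integral_nonneg fun s => by positivity)]
    exact enorm_stftDistribution_le g ψ w
  rw [eLpNorm_const_smul, ← ofReal_norm, Complex.norm_real,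
      Real.norm_of_nonneg (integral_nonneg fun s => by positivity)] at h3
  exact (ENNReal.mul_lt_top_iff.1 h3).elim And.right (fun h => h.elim (fun h => absurd h hc0)
    fun h => h ▸ ENNReal.zero_lt_top)

theorem exists_toTemperedDistribution_eq_of_le (ψ : 𝓢'(TFSpace d, ℂ)) (C : ℝ)
    (hC : ∀ h : 𝓢(TFSpace d, ℂ), ‖ψ h‖ ≤ C * ‖h.toLp 2 volume‖) :
    ∃ ψ₀ : Lp ℂ 2 (volume : Measure (TFSpace d)), Lp.toTemperedDistribution ψ₀ = ψ := by
  obtain ⟨Ψ, hΨ⟩ := LinearMap.exists_strongDual_comp_eq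
    (SchwartzMap.toLpCLM ℂ ℂ 2 (volume : Measure (TFSpace d))).toLinearMap
    (SchwartzMap.injective_toLp 2 volume) (ψ : 𝓢(TFSpace d, ℂ) →ₗ[ℂ] ℂ) C hC
  set v := (InnerProductSpace.toDual ℂ (Lp ℂ 2 (volume : Measure (TFSpace d)))).symm Ψ with hv
  -- The Riesz vector is conjugated, as the distributional pairing is bilinear and the inner product
  -- is not.
  have hvm : MemLp (fun t => starRingEnd ℂ (v t)) 2 volume :=
    (Lp.memLp v).congr_norm (Complex.continuous_conj.comp_aestronglyMeasurable (Lp.memLp v).1)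
      (Filter.Eventually.of_forall fun t => (RCLike.norm_conj _).symm)
  refine ⟨hvm.toLp _, ?_⟩
  ext h
  have h1 : inner ℂ v (h.toLp 2 volume) = ψ h := by
    rw [hv, InnerProductSpace.toDual_symm_apply]
    exact hΨ h
  rw [← h1, L2.inner_def, Lp.toTemperedDistribution_apply]
  refine integral_congr_ae ?_
  filter_upwards [hvm.coeFn_toLp, h.coeFn_toLp 2 volume] with t h2 h3
  rw [h2, RCLike.inner_apply, h3, smul_eq_mul]

/-- Cauchy-Schwarz in the inversion formula, with `‖V_g h̄‖ = ‖g‖ ‖h‖`, bounds `ψ` by the `L²` norm.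
-/
theorem exists_toTemperedDistribution_eq {p : ℝ≥0∞} (hp : 1 ≤ p) (hp' : p ≤ 2)
    {g : 𝓢(TFSpace d, ℂ)} (hg : g ≠ 0) {ψ : 𝓢'(TFSpace d, ℂ)} (hψ : ψ ∈ modulationSpace g p) :
    ∃ ψ₀ : Lp ℂ 2 (volume : Measure (TFSpace d)), Lp.toTemperedDistribution ψ₀ = ψ := by
  have hV : MemLp (stftDistribution g ψ) 2 volume :=
    ⟨(continuous_stftDistribution g ψ).aestronglyMeasurable,
      eLpNorm_stftDistribution_two_lt_top hp hp' hg hψ⟩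
  have hg0 := SchwartzMap.norm_toLp_two_pos hg
  refine exists_toTemperedDistribution_eq_of_le ψ
    (‖g.toLp 2 volume‖⁻¹ * ‖hV.toLp _‖) fun h => ?_
  have h1 : ((‖g.toLp 2 volume‖ ^ 2 : ℝ) : ℂ) * ψ h
      = inner ℂ (stftCLM (g.toLp 2 volume) (h.conj.toLp 2 volume)) (hV.toLp _) := by
    rw [← SchwartzMap.integral_norm_sq_eq_norm_toLp_sq,
      TemperedDistribution.mul_integral_norm_sq_eq, L2.inner_def]
    refine integral_congr_ae ?_
    filter_upwards [coeFn_stftCLM (g.toLp 2 volume) (h.conj.toLp 2 volume), hV.coeFn_toLp]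
      with z h2 h3
    rw [RCLike.inner_apply, h2, h3, stft_congr_ae (g.coeFn_toLp 2 volume)
      (h.conj.coeFn_toLp 2 volume), mul_comm]
  have h2 := congrArg norm h1
  rw [norm_mul, Complex.norm_real, Real.norm_of_nonneg (by positivity)] at h2
  have h3 := h2.le.trans (norm_inner_le_norm _ _)
  have h4 : ‖h.conj.toLp 2 volume‖ = ‖h.toLp 2 volume‖ := by
    rw [SchwartzMap.norm_toLp, SchwartzMap.norm_toLp]
    congr 1
    refine eLpNorm_congr_norm_ae (Filter.Eventually.of_forall fun t => ?_)
    rw [SchwartzMap.conj_apply, RCLike.norm_conj]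
  rw [norm_stftCLM, h4] at h3
  rw [← mul_le_mul_iff_right₀ (pow_pos hg0 2)]
  refine h3.trans (le_of_eq ?_)
  field_simp

/-! ### The embedding of modulation spaces into Lebesgue spaces -/

/-- The transform is moved off `u` onto `𝓕 ζ (ω - ·)`, where Fourier inversion recovers `ζ` times a
character. -/
theorem fourier_mul_schwartz (u : TFSpace d → ℂ) (hu : Integrable u) (ζ : 𝓢(TFSpace d, ℂ))
    (ω : TFSpace d) :
    𝓕 (fun t => u t * ζ t) ω = ∫ ν, 𝓕 ζ (ω - ν) * 𝓕 u ν := by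
  have hi : Integrable fun ν => 𝓕 ζ (ω - ν) := (𝓕 ζ).integrable.comp_sub_left ω
  have h1 : ∫ ν, (𝓕 ζ (ω - ν)) • 𝓕 u ν = ∫ t, 𝓕 (fun ν => 𝓕 ζ (ω - ν)) t • u t :=
    (VectorFourier.integral_fourierIntegral_smul_eq_flip (L := innerₗ (TFSpace d))
      Real.continuous_fourierChar (by exact continuous_inner) hi hu |>.trans (by
        rw [flip_innerₗ]; rfl)).symm
  simp only [smul_eq_mul] at h1
  rw [h1, fourier_apply_eq_integral_tfCharConj]
  refine integral_congr_ae (Filter.Eventually.of_forall fun t => ?_)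
  have h2 : 𝓕 (fun ν => 𝓕 ζ (ω - ν)) t = tfCharConj ω t * ζ t := by
    have h3 : ζ t = 𝓕⁻ (𝓕 ζ) t := by
      rw [FourierTransform.fourierInv_fourier_eq (F := 𝓢(TFSpace d, ℂ)) ζ]
    rw [h3, SchwartzMap.fourierInv_coe, fourierInv_apply_eq_integral_tfCharConj,
      fourier_apply_eq_integral_tfCharConj, ← integral_const_mul,
      ← integral_sub_left_eq_self _ volume ω]
    refine integral_congr_ae (Filter.Eventually.of_forall fun ν => ?_)
    simp only [sub_sub_cancel]
    rw [sub_eq_add_neg, tfCharConj_add_right, tfCharConj_neg_right, tfCharConj_comm t ω]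
    ring
  simp only [h2]
  ring

theorem enorm_fourier_mul_compSubConstCLM_le (u : TFSpace d → ℂ) (hu : Integrable u)
    (v : 𝓢(TFSpace d, ℂ)) (x ω : TFSpace d) :
    ‖𝓕 (fun t => u t * v.compSubConstCLM ℂ x t) ω‖ₑ ≤ ∫⁻ ν, ‖𝓕 v (ω - ν)‖ₑ * ‖𝓕 u ν‖ₑ := by
  rw [fourier_mul_schwartz u hu]
  refine (enorm_integral_le_lintegral_enorm _).trans (le_of_eq (lintegral_congr fun ν => ?_))
  rw [enorm_mul, ← ofReal_norm, norm_fourier_compSubConstCLM_apply, ofReal_norm]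

theorem eLpNorm_mul_compSubConstCLM_le {p p' : ℝ≥0∞} [ENNReal.HolderConjugate p p'] (hp : p ≤ 2)
    (v k : 𝓢(TFSpace d, ℂ)) (hk : 𝓕 v = k) (u : TFSpace d → ℂ) (x : TFSpace d) (hu : Integrable u)
    (hu2 : MemLp (fun t => u t * v.compSubConstCLM ℂ x t) 2) :
    eLpNorm (fun t => u t * v.compSubConstCLM ℂ x t) 2 ≤ eLpNorm k p' ^ (1 - p.toReal / 2)
      * eLpNorm k 1 ^ (p.toReal / 2) * eLpNorm (𝓕 u) p := by
  have hi : Integrable fun t => u t * v.compSubConstCLM ℂ x t :=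
    hu.mul_bdd (c := SchwartzMap.seminorm ℂ 0 0 (v.compSubConstCLM ℂ x))
      (v.compSubConstCLM ℂ x).continuous.aestronglyMeasurable
      (Filter.Eventually.of_forall fun t => (v.compSubConstCLM ℂ x).norm_le_seminorm ℂ t)
  have h1 := eLpNorm_two_conv_le (ν := (volume : Measure (TFSpace d))) (p' := p')
    k.continuous.measurable (continuous_fourier_of_integrable hu).measurable hp
  rw [← eLpNorm_fourier_two hi hu2]
  refine le_trans (eLpNorm_mono_enorm fun ω => ?_) h1
  rw [enorm_eq_self, ← hk]
  exact enorm_fourier_mul_compSubConstCLM_le u hu v x ω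

/-- The constant is uniform in `x`: translating `v` changes its Fourier transform only by a phase.
-/
theorem exists_eLpNorm_mul_schwartz_le {p : ℝ≥0∞} (hp : 1 ≤ p) (hp' : p ≤ 2)
    (v : 𝓢(TFSpace d, ℂ)) :
    ∃ D : ℝ≥0∞, D ≠ ∞ ∧ ∀ (u : TFSpace d → ℂ) (x : TFSpace d), Integrable u →
      MemLp (fun t => u t * v (t - x)) 2 →
      eLpNorm (fun t => u t * v (t - x)) 2 ≤ D * eLpNorm (𝓕 u) p := by
  have hpq : ENNReal.HolderConjugate p (1 - p⁻¹)⁻¹ := ENNReal.HolderConjugate.inv_one_sub_inv' hp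
  have hp2 : p.toReal ≤ 2 := by
    have := ENNReal.toReal_mono ENNReal.ofNat_ne_top hp'; simpa using this
  obtain ⟨k, hk⟩ : ∃ k : 𝓢(TFSpace d, ℂ), 𝓕 v = k := ⟨_, rfl⟩
  refine ⟨eLpNorm k (1 - p⁻¹)⁻¹ ^ (1 - p.toReal / 2) * eLpNorm k 1 ^ (p.toReal / 2), ?_,
    fun u x hu hu2 => ?_⟩
  · have h1 : eLpNorm k (1 - p⁻¹)⁻¹ volume ≠ ∞ := (k.memLp (1 - p⁻¹)⁻¹ volume).2.ne
    have h2 : eLpNorm k 1 volume ≠ ∞ := (k.memLp 1 volume).2.ne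
    have h3 : 0 ≤ 1 - p.toReal / 2 := by linarith
    have h4 : 0 ≤ p.toReal / 2 := by positivity
    exact ENNReal.mul_ne_top (ENNReal.rpow_ne_top_of_nonneg h3 h1)
      (ENNReal.rpow_ne_top_of_nonneg h4 h2)
  · have h := eLpNorm_mul_compSubConstCLM_le (p' := (1 - p⁻¹)⁻¹) hp' v k hk u x hu
    simp only [SchwartzMap.compSubConstCLM_apply] at h
    exact h hu2

theorem lintegral_eLpNorm_mul_comp_sub_rpow {f w : TFSpace d → ℂ} (hf : Measurable f)
    (hw : Measurable w) {p : ℝ≥0∞} (hp : p ≠ 0) (hp' : p ≠ ∞) :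
    ∫⁻ x, eLpNorm (fun t => f t * w (t - x)) p ^ p.toReal
      = (eLpNorm w p * eLpNorm f p) ^ p.toReal := by
  have hq : 0 < p.toReal := ENNReal.toReal_pos hp hp'
  have e : ∀ {α : Type} [MeasurableSpace α] (μ : Measure α) (u : α → ℂ),
      eLpNorm u p μ ^ p.toReal = ∫⁻ t, ‖u t‖ₑ ^ p.toReal ∂μ := fun μ u => by
    rw [eLpNorm_eq_lintegral_rpow_enorm_toReal hp hp', ← ENNReal.rpow_mul,
      one_div_mul_cancel hq.ne', ENNReal.rpow_one]
  have hm : Measurable fun r : TFSpace d × TFSpace d => f r.2 * w (r.2 - r.1) :=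
    (hf.comp measurable_snd).mul (hw.comp (measurable_snd.sub measurable_fst))
  rw [ENNReal.mul_rpow_of_nonneg _ _ hq.le]
  simp only [e]
  rw [lintegral_lintegral_swap (hm.enorm.pow_const _).aemeasurable,
    ← lintegral_const_mul _ (hf.enorm.pow_const _)]
  refine lintegral_congr fun t => ?_
  have hwt : Measurable fun x => ‖w (t - x)‖ₑ ^ p.toReal :=
    (hw.comp (measurable_const.sub measurable_id)).enorm.pow_const _
  simp only [enorm_mul, ENNReal.mul_rpow_of_nonneg _ _ hq.le]
  rw [lintegral_const_mul _ hwt, mul_comm,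
    lintegral_sub_left_eq_self (fun x => ‖w x‖ₑ ^ p.toReal) t]

theorem lintegral_eLpNorm_prodMk_rpow {V : TFPlane d → ℂ} (hV : Measurable V) {p : ℝ≥0∞}
    (hp : p ≠ 0) (hp' : p ≠ ∞) :
    ∫⁻ x, eLpNorm (fun ω => V (x, ω)) p ^ p.toReal = eLpNorm V p volume ^ p.toReal := by
  have hq : 0 < p.toReal := ENNReal.toReal_pos hp hp'
  have e : ∀ {α : Type} [MeasurableSpace α] (μ : Measure α) (u : α → ℂ),
      eLpNorm u p μ ^ p.toReal = ∫⁻ t, ‖u t‖ₑ ^ p.toReal ∂μ := fun μ u => by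
    rw [eLpNorm_eq_lintegral_rpow_enorm_toReal hp hp', ← ENNReal.rpow_mul,
      one_div_mul_cancel hq.ne', ENNReal.rpow_one]
  simp only [e]
  rw [Measure.volume_eq_prod, lintegral_prod _ (hV.enorm.pow_const _).aemeasurable]

/-- The embedding `M^p ⊆ L^p` for `1 ≤ p ≤ 2`. -/
theorem exists_eLpNorm_le_eLpNorm_stft {p : ℝ≥0∞} (hp : 1 ≤ p) (hp' : p ≤ 2)
    {g : 𝓢(TFSpace d, ℂ)} (hg : g ≠ 0) :
    ∃ C : ℝ≥0∞, C ≠ ∞ ∧ ∀ f : Lp ℂ 2 (volume : Measure (TFSpace d)),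
      eLpNorm f p ≤ C * eLpNorm (stft g f) p volume := by
  have hp0 : p ≠ 0 := (zero_lt_one.trans_le hp).ne'
  have hpt : p ≠ ∞ := ne_top_of_le_ne_top ENNReal.ofNat_ne_top hp'
  have hq : 0 < p.toReal := ENNReal.toReal_pos hp0 hpt
  obtain ⟨D, hD, hDle⟩ := exists_eLpNorm_mul_schwartz_le hp hp' g.conj
  -- Hölder exponent with `1/p = 1/2 + 1/r`; it is `∞` when `p = 2`.
  set r : ℝ≥0∞ := (p⁻¹ - 2⁻¹)⁻¹ with hr
  have hpqr : ENNReal.HolderTriple 2 r p := ⟨by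
    rw [hr, inv_inv, add_tsub_cancel_of_le (ENNReal.inv_le_inv.2 hp')]⟩
  set w := g.conj with hw
  -- The cube of the window: one factor forms the short-time transform, one smooths on the Fourier
  -- side from `L^p` to `L²`, and one serves Hölder from `L²` to `L^p`.
  set w3 : 𝓢(TFSpace d, ℂ) := SchwartzMap.pairing (ContinuousLinearMap.mul ℂ ℂ) w
    (SchwartzMap.pairing (ContinuousLinearMap.mul ℂ ℂ) w w) with hw3
  have hw3' : ∀ t, w3 t = w t * (w t * w t) := fun t => by simp [hw3]
  have hw30 : eLpNorm w3 p volume ≠ 0 := by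
    intro h
    rw [eLpNorm_eq_zero_iff w3.continuous.aestronglyMeasurable hp0] at h
    have h1 := (Continuous.ae_eq_iff_eq volume w3.continuous continuous_zero).1 h
    apply hg
    ext t
    have h2 := congrFun h1 t
    rw [hw3', SchwartzMap.conj_apply] at h2
    simpa using h2
  have hx : ∀ (f : Lp ℂ 2 (volume : Measure (TFSpace d))) (x : TFSpace d),
      eLpNorm (fun t => f t * w3 (t - x)) p
        ≤ D * eLpNorm w r volume * eLpNorm (fun ω => stft g f (x, ω)) p := by
    intro f x
    have hu := integrable_mul_conj_comp_sub (g.memLp 2 volume) (Lp.memLp f) x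
    have e1 : ∀ t, starRingEnd ℂ (g (t - x)) = w (t - x) := fun t =>
      (SchwartzMap.conj_apply g _).symm
    have e2 : (fun ω => stft g f (x, ω)) = 𝓕 fun t => f t * w (t - x) := by
      funext ω
      rw [stft_eq_fourier]
      simp only [e1]
    simp only [e1] at hu
    set wx : TFSpace d → ℂ := fun t => w (t - x) with hwx
    have hwxc : Continuous wx := w.continuous.comp (continuous_id.sub continuous_const)
    have hb : ∀ᵐ t, ‖wx t‖ ≤ SchwartzMap.seminorm ℂ 0 0 w :=
      Filter.Eventually.of_forall fun t => w.norm_le_seminorm ℂ _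
    have hwtop : MemLp wx ∞ volume := memLp_top_of_bound hwxc.aestronglyMeasurable _ hb
    have hu2 : MemLp (fun t => f t * wx t * wx t) 2 :=
      (hwtop.mul (r := 2) (hwtop.mul (r := 2) (Lp.memLp f)))
    have h1 := hDle _ x hu hu2
    have h2 := eLpNorm_smul_le_mul_eLpNorm (p := 2) (q := r) (r := p) (μ := volume)
      hwxc.aestronglyMeasurable hu2.1
    have h3 : eLpNorm wx r volume = eLpNorm w r volume :=
      eLpNorm_comp_measurePreserving w.continuous.aestronglyMeasurable
        (measurePreserving_sub_right volume x)
    have h4 : (fun t => f t * w3 (t - x)) = (fun t => f t * wx t * wx t) • wx := by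
      funext t
      rw [hw3', Pi.smul_apply', smul_eq_mul]
      ring
    rw [h4, e2]
    refine h2.trans ?_
    rw [h3, mul_right_comm]
    exact mul_le_mul_left h1 _
  refine ⟨(eLpNorm w3 p volume)⁻¹ * (D * eLpNorm w r volume),
    ENNReal.mul_ne_top (ENNReal.inv_ne_top.2 hw30)
      (ENNReal.mul_ne_top hD (w.memLp _ _).2.ne), fun f => ?_⟩
  -- Integrating the `p`-th powers of the local bounds over `x` makes both sides global by Tonelli.
  have h5 : (eLpNorm w3 p volume * eLpNorm f p volume) ^ p.toReal
      ≤ (D * eLpNorm w r volume * eLpNorm (stft g f) p volume) ^ p.toReal := by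
    rw [← lintegral_eLpNorm_mul_comp_sub_rpow (measurable_coe_Lp f) w3.continuous.measurable hp0
      hpt, ENNReal.mul_rpow_of_nonneg _ _ hq.le, ← lintegral_eLpNorm_prodMk_rpow
      (stronglyMeasurable_stft g.continuous.measurable (measurable_coe_Lp f)).measurable hp0 hpt,
      ← lintegral_const_mul' _ _ (ENNReal.rpow_ne_top_of_nonneg hq.le
        (ENNReal.mul_ne_top hD (w.memLp _ _).2.ne))]
    refine lintegral_mono fun x => ?_
    rw [← ENNReal.mul_rpow_of_nonneg _ _ hq.le]
    exact ENNReal.rpow_le_rpow (hx f x) hq.le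
  have h6 := (ENNReal.rpow_le_rpow_iff hq).1 h5
  calc eLpNorm f p volume
      = (eLpNorm w3 p volume)⁻¹ * (eLpNorm w3 p volume * eLpNorm f p volume) := by
        rw [← mul_assoc, ENNReal.inv_mul_cancel hw30 (w3.memLp _ _).2.ne, one_mul]
    _ ≤ (eLpNorm w3 p volume)⁻¹ * (D * eLpNorm w r volume * eLpNorm (stft g f) p volume) := by
        gcongr
    _ = _ := by ring

end Modulation

/-! ### The `L^p` bound for the blurring operator -/

theorem mainTheorem7 (d : ℕ) (p : ℝ≥0∞) (hp₁ : 1 ≤ p) (hp₂ : p ≤ 2)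
    (g : 𝓢(TFSpace d, ℂ)) (hg : g ≠ 0)
    (φ : 𝓢'(TFSpace d, ℂ)) (hφ : φ ∈ modulationSpace g 1) :
    ∃ C : ℝ≥0, ∀ μ : TFPlane d → ℂ, MemLp μ 1 volume → ∀ ψ ∈ modulationSpace g p,
      ∃ f : Lp ℂ 2 (volume : Measure (TFSpace d)), IsBlurring μ φ ψ f ∧
        MemLp f p volume ∧
        eLpNorm f p volume ≤ C * eLpNorm μ 1 volume * modulationNorm g p ψ := by
  have hpt : p ≠ ∞ := ne_top_of_le_ne_top ENNReal.ofNat_ne_top hp₂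
  obtain ⟨φ₀, rfl⟩ := exists_toTemperedDistribution_eq le_rfl one_le_two hg hφ
  obtain ⟨C, hC, hCle⟩ := exists_eLpNorm_le_eLpNorm_stft hp₁ hp₂ hg
  set γ := g.toLp 2 volume with hγ
  have hγ' : ∀ f : TFSpace d → ℂ, stft g f = stft γ f := fun f =>
    stft_congr_ae (g.coeFn_toLp 2 volume).symm (Filter.EventuallyEq.refl _ _)
  have hnorm : ∀ (p : ℝ≥0∞) (f : Lp ℂ 2 (volume : Measure (TFSpace d))),
      modulationNorm g p (Lp.toTemperedDistribution f) = eLpNorm (stft γ f) p volume := by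
    intro p f
    rw [modulationNorm, ← hγ', funext (stftDistribution_toTemperedDistribution g f)]
  set c := ENNReal.ofReal (‖γ‖ ^ 2) with hc
  have hc0 : c ≠ 0 := by simpa [hc] using (SchwartzMap.norm_toLp_two_pos hg).ne'
  set A := eLpNorm (stft γ φ₀) 1 volume with hA
  have hAt : A ≠ ∞ := by
    rw [hA, ← hnorm]; exact ne_of_lt hφ
  -- `C` is the embedding constant, the first `A` comes from the adjoint, and `c⁻¹ * A` from
  -- changing the window `γ` to `φ₀`.
  have hK : C * A * (c⁻¹ * A) ≠ ∞ := ENNReal.mul_ne_top (ENNReal.mul_ne_top hC hAt)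
    (ENNReal.mul_ne_top (ENNReal.inv_ne_top.2 hc0) hAt)
  refine ⟨(C * A * (c⁻¹ * A)).toNNReal, fun μ hμ ψ hψ => ?_⟩
  obtain ⟨ψ₀, rfl⟩ := exists_toTemperedDistribution_eq hp₁ hp₂ hg hψ
  have hVm := (stronglyMeasurable_stft (measurable_coe_Lp φ₀) (measurable_coe_Lp ψ₀)).measurable
  have hFm := aestronglyMeasurable_convolution_mul hμ.1 hVm
  -- Existence uses the convolution bound at exponent `2`; the norm estimate below uses it at `p`.
  obtain ⟨f, hf⟩ := exists_isAdjointSTFT φ₀ ⟨hFm,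
    (eLpNorm_convolution_mul_le hμ.1 hVm one_le_two ENNReal.ofNat_ne_top).trans_lt
      (ENNReal.mul_lt_top hμ.2 (memLp_stft φ₀ ψ₀).2)⟩
  have hle : eLpNorm f p volume ≤ (C * A * (c⁻¹ * A)).toNNReal * eLpNorm μ 1 volume
      * modulationNorm g p (Lp.toTemperedDistribution ψ₀) := by
    rw [ENNReal.coe_toNNReal hK, hnorm]
    have h1 : eLpNorm (stft φ₀ ψ₀) p volume ≤ c⁻¹ * A * eLpNorm (stft γ ψ₀) p volume := by
      have := eLpNorm_stft_le γ φ₀ ψ₀ hp₁ hpt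
      calc eLpNorm (stft φ₀ ψ₀) p volume = c⁻¹ * (c * eLpNorm (stft φ₀ ψ₀) p volume) := by
            rw [← mul_assoc, ENNReal.inv_mul_cancel hc0 ENNReal.ofReal_ne_top, one_mul]
        _ ≤ c⁻¹ * (A * eLpNorm (stft γ ψ₀) p volume) := by gcongr
        _ = _ := by rw [mul_assoc]
    calc eLpNorm f p volume ≤ C * eLpNorm (stft γ f) p volume := by
          rw [← hγ']; exact hCle f
      _ ≤ C * (A * (eLpNorm μ 1 volume * (c⁻¹ * A * eLpNorm (stft γ ψ₀) p volume))) := by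
          gcongr
          refine (hf.eLpNorm_stft_le hFm γ hp₁ hpt).trans ?_
          gcongr
          refine (eLpNorm_convolution_mul_le hμ.1 hVm hp₁ hpt).trans ?_
          gcongr
      _ = _ := by ring
  refine ⟨f, ⟨φ₀, ψ₀, rfl, rfl, hf⟩, ⟨(Lp.memLp f).1, hle.trans_lt ?_⟩, hle⟩
  exact ENNReal.mul_lt_top (ENNReal.mul_lt_top ENNReal.coe_lt_top hμ.2) hψ
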